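/- Let $A,B$ be finite alphabets with $2\le \mathrm{Card}(B)<\mathrm{Card}(A)$, let $\pi:A\to B$ be surjective, and write also $\pi:A^{\mathbb N}\to B^{\mathbb N}$, $(\pi a)_n=\pi(a_n)$, where $\mathbb N=\{0,1,2,\dots\}$. Let $T$ be the shift, $S_n\psi=\sum_{k=0}^{n-1}\psi\circ T^k$, let $[a_m^n]$ be the cylinder of all sequences beginning with the word $a_ma_{m+1}\cdots a_n$, and let $\mathrm{var}_n\psi=\sup\{|\psi(a)-\psi(b)|:\ a_i=b_i \text{ for } 0\le i\le n\}\in[0,\infty]$. A $T$-invariant Borel probability measure $\mu$ is a *Gibbs measure* for a continuous potential $\psi$ if there are $C\ge 1$ and $P\in\mathbb R$ such that $$C^{-1}\le \frac{\mu[a_0^n]}{\exp(S_{n+1}\psi(a)-(n+1)P)}\le C\qquad\text{for all } n\in\mathbb N \text{ and all sequences } a .$$ The potential $\psi$ is *normalized* if its topological pressure $P(\psi)=\limsup_{n\to\infty}\frac1n\log\sum_{T^na=a}\exp(S_n\psi(a))$ is $0$. For $r\ge 1$, an *$(r+1)$-symbol approximant* of $\psi$ is a function $\psi_r$ with $\sup_a|\psi(a)-\psi_r(a)|\le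 \mathrm{var}_r\psi$ for which $\psi_r(a)$ depends only on $a_0,\dots,a_r$; for instance $\psi_r(a)=\sup\{\psi(b): b\in[a_0^r]\}$. **Theorem.** Let $\psi:A^{\mathbb N}\to\mathbb R$ satisfy $\sum_{s=0}^\infty s^2\,\mathrm{var}_s\psi<\infty$. Then $\psi$ has a unique Gibbs measure $\mu_\psi$, and so does every $(r+1)$-symbol approximant $\psi_r$ of $\psi$, $r\ge 1$; write $\mu_{\psi_r}$ for the latter. The measure $\mu_\psi\circ\pi^{-1}$ is a Gibbs measure, with support $B^{\mathbb N}$, for a normalized potential $\phi:B^{\mathbb N}\to\mathbb R$ (with $P=0$ in the Gibbs inequality), and for every $b\in B^{\mathbb N}$ $$\phi(b)=\lim_{r\to\infty}\lim_{n\to\infty}\log\frac{\mu_{\psi_r}\circ\pi^{-1}[b_0^n]}{\mu_{\psi_r}\circ\pi^{-1}[b_1^n]},$$ for every choice of the approximants $\psi_r$ $(r\ge1)$; all these limits exist. Moreover: 1. If $\mathrm{var}_n\psi\le C\exp(-c\,n^{\gamma})$ for all $n\in\mathbb N$, with $c,C>0$ and $0<\gamma<1$, then there are $D>C$ and $0<d<c$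 such that $\mathrm{var}_n\phi\le D\exp\bigl(-d\,n^{\gamma/(1+\gamma)}\bigr)$ for all $n\in\mathbb N$. 2. If $\mathrm{var}_n\psi\le C n^{-q}$ for all $n\ge1$, with $C>0$ and $q>3$, then for every $\varepsilon\in(0,q-3)$ there is $D>C$ such that $\mathrm{var}_n\phi\le D\,n^{-(q-2-\varepsilon)}$ for all $n\ge 1$. -/

import Mathlib

open MeasureTheory Filter Topology
open scoped ENNReal

namespace GibbsAmalgamation

/-- The shift map on one-sided sequences, `(T a)_n = a_{n+1}`. -/
def shift {A : Type*} (a : ℕ → A) : ℕ → A := fun n => a (n + 1)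

/-- The coordinatewise extension of a map of alphabets to sequences. -/
def amalgam {A B : Type*} (π : A → B) (a : ℕ → A) : ℕ → B := fun n => π (a n)

/-- The cylinder `[a_m^n]`: all sequences that begin with the word `a_m a_{m+1} ⋯ a_n`
(a word of length `n - m + 1`, for `m ≤ n`). -/
def cyl {A : Type*} (a : ℕ → A) (m n : ℕ) : Set (ℕ → A) :=
  {x | ∀ i, m + i ≤ n → x i = a (m + i)}

/-- The `n`-th variation of a potential, the supremum of `|ψ a - ψ b|` over all `a`, `b` with
`a_0^n = b_0^n`. It takes values in `[0, ∞]`, so an infinite supremum is really infinite. -/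
noncomputable def var {A : Type*} (n : ℕ) (ψ : (ℕ → A) → ℝ) : ℝ≥0∞ :=
  ⨆ (a : ℕ → A) (b : ℕ → A) (_ : ∀ i ≤ n, a i = b i), ENNReal.ofReal |ψ a - ψ b|

/-- `μ` is a Gibbs measure for the continuous potential `ψ` on the full shift, with constant `P`
in the Gibbs inequality: `μ` is a shift-invariant probability measure and
`C⁻¹ ≤ μ[a_0^n] / exp (S_{n+1} ψ (a) - (n+1) P) ≤ C` for all `n` and `a`.
Here `birkhoffSum shift ψ n a` is `S_n ψ (a) = ∑_{k<n} ψ (T^k a)`. -/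
structure IsGibbsWith {A : Type*} [TopologicalSpace A] [MeasurableSpace A]
    (μ : Measure (ℕ → A)) (ψ : (ℕ → A) → ℝ) (P : ℝ) : Prop where
  continuous : Continuous ψ
  isProbabilityMeasure : IsProbabilityMeasure μ
  invariant : MeasurePreserving shift μ μ
  gibbs_inequality : ∃ C : ℝ, 1 ≤ C ∧ ∀ (n : ℕ) (a : ℕ → A),
    C⁻¹ ≤ μ.real (cyl a 0 n) / Real.exp (birkhoffSum shift ψ (n + 1) a - (n + 1) * P) ∧
    μ.real (cyl a 0 n) / Real.exp (birkhoffSum shift ψ (n + 1) a - (n + 1) * P) ≤ C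

/-- `μ` is a Gibbs measure for the potential `ψ` on the full shift. -/
def IsGibbs {A : Type*} [TopologicalSpace A] [MeasurableSpace A]
    (μ : Measure (ℕ → A)) (ψ : (ℕ → A) → ℝ) : Prop :=
  ∃ P : ℝ, IsGibbsWith μ ψ P

/-- The topological pressure of `ψ` on the full shift,
`limsup_n (1/n) log ∑ exp (S_n ψ (a))`, the sum being over the (finitely many) points `a` with
`T^n a = a`. -/
noncomputable def pressure {A : Type*} (ψ : (ℕ → A) → ℝ) : EReal :=
  limsup (fun n : ℕ => ((1 / (n : ℝ) * Real.log
    (∑ᶠ a ∈ Function.ptsOfPeriod (shift (A := A)) n, Real.exp (birkhoffSum shift ψ n a)) : ℝ) :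
      EReal)) atTop

/-- `χ` is an `(r+1)`-symbol approximant of `ψ`: it depends only on the coordinates `0, …, r`, and
its uniform distance to `ψ` is at most the `r`-th variation of `ψ`. -/
def IsApproximant {A : Type*} (r : ℕ) (ψ χ : (ℕ → A) → ℝ) : Prop :=
  (∀ a b : ℕ → A, (∀ i ≤ r, a i = b i) → χ a = χ b) ∧
    ∀ a : ℕ → A, ENNReal.ofReal |ψ a - χ a| ≤ var r ψ

/-- The standard choice `a ↦ sup {ψ b : b ∈ [a_0^r]}` is an `(r+1)`-symbol approximant. -/
theorem isApproximant_sSup {A : Type*} (r : ℕ) (ψ : (ℕ → A) → ℝ) :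
    IsApproximant r ψ (fun a => sSup (ψ '' cyl a 0 r)) := by
  refine ⟨fun a b h => ?_, fun a => ?_⟩
  · have : cyl a 0 r = cyl b 0 r := by
      ext x
      simp only [cyl, Set.mem_ofPred_eq, zero_add]
      exact forall₂_congr fun i hi => by rw [h i hi]
    simp only [this]
  · by_cases htop : var r ψ = ∞
    · rw [htop]; exact le_top
    have hb : ∀ x ∈ cyl a 0 r, |ψ a - ψ x| ≤ (var r ψ).toReal := by
      intro x hx
      rw [← ENNReal.ofReal_le_iff_le_toReal htop]
      refine le_iSup_of_le a (le_iSup_of_le x (le_iSup_of_le ?_ le_rfl))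
      intro i hi
      have := hx i (by omega)
      simpa using this.symm
    have ha : a ∈ cyl a 0 r := fun i _ => by simp
    have hbdd : BddAbove (ψ '' cyl a 0 r) := by
      refine ⟨ψ a + (var r ψ).toReal, ?_⟩
      rintro _ ⟨x, hx, rfl⟩
      have := (abs_le.mp (hb x hx)).1
      linarith
    rw [ENNReal.ofReal_le_iff_le_toReal htop]
    have h1 : ψ a ≤ sSup (ψ '' cyl a 0 r) := le_csSup hbdd ⟨a, ha, rfl⟩
    have h2 : sSup (ψ '' cyl a 0 r) ≤ ψ a + (var r ψ).toReal := by
      refine csSup_le ⟨_, a, ha, rfl⟩ ?_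
      rintro _ ⟨x, hx, rfl⟩
      have := (abs_le.mp (hb x hx)).1
      linarith
    rw [abs_le]
    constructor <;> linarith [ENNReal.toReal_nonneg (a := var r ψ)]

end GibbsAmalgamation

/-!
The proof rests on loss of memory. For a fixed image sequence `b`, let `L_i` be the transfer
operator of `ψ` summed only over the symbols above `b_i`. If `f` and `g` are positive and their logarithms
vary by at most the tail `t m = ∑_{k ≥ m} var_k ψ` on cylinders of length `m`, then so do those of
`L_n ⋯ L_1 f` and `L_n ⋯ L_1 g` (`HasTail.transferIter_le`). A block of `r` operators therefore
compares any two end points up to the constant `exp (2 t 0)`, except for the error made by ignoring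
the symbols beyond the next `r`, which is of order `t r`. So the oscillation of the quotient
`L_n ⋯ L_1 f / L_n ⋯ L_1 g` is contracted by a fixed factor per block, and altogether it is at most
`memoryRate t n r = θ ^ (n / r) + K t r` for every block length `r` (`HasTail.exists_band`). The
constants depend on `t` only.

* With unrestricted sums this gives the Perron eigendata `(l, h)` of the full transfer operator
  (`HasTail.exists_isEigen`). The laws of the Markov chain that prepends symbols with probabilities
  `exp (ψ (x z)) h (x z) / (l h z)` accumulate at an invariant measure satisfying the Gibbs
  inequality (`IsEigen.exists_isCompatible`, `IsCompatible.isGibbsWith`). Gibbs measures are ergodic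
  because words concatenate freely up to a constant, and two of them for the same potential are
  equivalent, hence equal (`HasTail.gibbs_unique`).
* The quotient `μ∘π⁻¹[b_0^n] / μ∘π⁻¹[b_1^n]` is trapped between the extreme values of
  `L_n ⋯ L_1 (l⁻¹ L_0 h) / L_n ⋯ L_1 h`. So it converges at the memory rate
  (`IsCompatible.exists_ratio_limit`), and `φ` is the logarithm of the limit. The hypothesis
  `∑ s² var_s ψ < ∞` gives `t r = O(r⁻²)`; blocks of length `n^(2/3)` then make the rate summable
  in `n`, and multiplying the quotients along an orbit yields the Gibbs inequality for `φ` with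
  `P = 0` (`isGibbsWith_map`).
* All approximants share the tail `3 ∑_{k ≥ m} var_k ψ`, so their limits in `n` are uniform in `r`;
  the measures of cylinders depend continuously on the potential (`tendsto_real_cylSet`).
  Together this identifies the double limit with `φ`.
* The decay of `var_n φ` follows by choosing blocks of length `n^(1/(1+γ))`, respectively `n^α` with
  `α (q - 2) = q - 2 - ε` (`exists_var_le_exp`, `exists_var_le_rpow`).
-/

namespace GibbsAmalgamation

/-! ### Transfer operators and their distortion -/

/-- The sequence `x z_0 z_1 ⋯`. -/
def prepend {A : Type*} (x : A) (z : ℕ → A) : ℕ → A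
  | 0 => x
  | n + 1 => z n

/-- The transfer operator of `ψ` restricted to the preimages whose first symbol lies in `s`:
`(L_s f)(z) = ∑_{x ∈ s} exp (ψ (x z)) f (x z)`. -/
noncomputable def transfer {A : Type*} (ψ : (ℕ → A) → ℝ) (s : Finset A) :
    ((ℕ → A) → ℝ) →ₗ[ℝ] ((ℕ → A) → ℝ) where
  toFun f z := ∑ x ∈ s, Real.exp (ψ (prepend x z)) * f (prepend x z)
  map_add' f g := by
    ext z
    simp only [Pi.add_apply, mul_add, Finset.sum_add_distrib]
  map_smul' c f := by
    ext z
    simp only [Pi.smul_apply, smul_eq_mul, RingHom.id_apply, Finset.mul_sum]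
    exact Finset.sum_congr rfl fun x _ => by ring

/-- The composition `L_{S (n-1)} ∘ ⋯ ∘ L_{S 0}` of restricted transfer operators. -/
noncomputable def transferIter {A : Type*} (ψ : (ℕ → A) → ℝ) (S : ℕ → Finset A) :
    ℕ → ((ℕ → A) → ℝ) →ₗ[ℝ] ((ℕ → A) → ℝ)
  | 0 => LinearMap.id
  | n + 1 => (transfer ψ (S n)).comp (transferIter ψ S n)

/-- `t` controls the variations of `ψ` through its increments: for `a_0^m = b_0^m` one has
`|ψ a - ψ b| ≤ t m - t (m + 1)`. The example to have in mind is the tail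
`t m = ∑_{k ≥ m} var_k ψ` of a convergent series. -/
structure HasTail {A : Type*} (ψ : (ℕ → A) → ℝ) (t : ℕ → ℝ) : Prop where
  nonneg : ∀ m, 0 ≤ t m
  abs_sub_le : ∀ m x y, (∀ i < m + 1, x i = y i) → |ψ x - ψ y| ≤ t m - t (m + 1)

/-- A nonnegative function whose logarithm varies by at most `t m` between two sequences that
agree in their first `m` symbols. This cone is preserved by the transfer operators of every
potential with tail `t`. -/
structure IsRegular {A : Type*} (t : ℕ → ℝ) (f : (ℕ → A) → ℝ) : Prop where
  nonneg : ∀ x, 0 ≤ f x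
  le_exp_mul : ∀ m x y, (∀ i < m, x i = y i) → f x ≤ Real.exp (t m) * f y

section Operators

variable {A : Type*} {ψ : (ℕ → A) → ℝ} {t : ℕ → ℝ}

theorem transfer_apply (s : Finset A) (f : (ℕ → A) → ℝ) (z : ℕ → A) :
    transfer ψ s f z = ∑ x ∈ s, Real.exp (ψ (prepend x z)) * f (prepend x z) := rfl

theorem transferIter_zero (S : ℕ → Finset A) (f : (ℕ → A) → ℝ) :
    transferIter ψ S 0 f = f := rfl

theorem transferIter_succ (S : ℕ → Finset A) (n : ℕ) (f : (ℕ → A) → ℝ) :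
    transferIter ψ S (n + 1) f = transfer ψ (S n) (transferIter ψ S n f) := rfl

theorem transferIter_add (S : ℕ → Finset A) (m n : ℕ) (f : (ℕ → A) → ℝ) :
    transferIter ψ S (m + n) f =
      transferIter ψ (fun i => S (m + i)) n (transferIter ψ S m f) := by
  induction n with
  | zero => rfl
  | succ n ih => rw [← add_assoc, transferIter_succ, ih, transferIter_succ]

theorem transferIter_succ' (S : ℕ → Finset A) (n : ℕ) (f : (ℕ → A) → ℝ) :
    transferIter ψ S (n + 1) f =
      transferIter ψ (fun i => S (i + 1)) n (transfer ψ (S 0) f) := by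
  rw [add_comm, transferIter_add]
  simp only [add_comm 1]
  rfl

theorem transferIter_congr {S S' : ℕ → Finset A} {n : ℕ} (h : ∀ i < n, S i = S' i)
    (f : (ℕ → A) → ℝ) : transferIter ψ S n f = transferIter ψ S' n f := by
  induction n with
  | zero => rfl
  | succ n ih =>
    rw [transferIter_succ, transferIter_succ, ih fun i hi => h i (by omega), h n (by omega)]

theorem transfer_mono (s : Finset A) {f g : (ℕ → A) → ℝ} (h : f ≤ g) :
    transfer ψ s f ≤ transfer ψ s g := fun _ =>
  Finset.sum_le_sum fun _ _ => mul_le_mul_of_nonneg_left (h _) (Real.exp_pos _).le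

theorem transferIter_mono (S : ℕ → Finset A) (n : ℕ) {f g : (ℕ → A) → ℝ} (h : f ≤ g) :
    transferIter ψ S n f ≤ transferIter ψ S n g := by
  induction n with
  | zero => exact h
  | succ n ih => exact transfer_mono _ ih

theorem transferIter_nonneg (S : ℕ → Finset A) (n : ℕ) {f : (ℕ → A) → ℝ} (h : 0 ≤ f) :
    0 ≤ transferIter ψ S n f := by
  simpa using transferIter_mono (ψ := ψ) S n h

theorem transfer_pos {s : Finset A} (hs : s.Nonempty) {f : (ℕ → A) → ℝ} (h : ∀ z, 0 < f z)
    (z : ℕ → A) : 0 < transfer ψ s f z :=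
  Finset.sum_pos (fun _ _ => mul_pos (Real.exp_pos _) (h _)) hs

theorem transferIter_pos {S : ℕ → Finset A} (hS : ∀ i, (S i).Nonempty) (n : ℕ)
    {f : (ℕ → A) → ℝ} (h : ∀ z, 0 < f z) (z : ℕ → A) : 0 < transferIter ψ S n f z := by
  induction n generalizing z with
  | zero => exact h z
  | succ n ih => exact transfer_pos (hS n) ih z

theorem transfer_le_univ [Fintype A] (s : Finset A) {f : (ℕ → A) → ℝ} (h : ∀ z, 0 ≤ f z) :
    transfer ψ s f ≤ transfer ψ Finset.univ f := fun _ =>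
  Finset.sum_le_sum_of_subset_of_nonneg (Finset.subset_univ s)
    fun _ _ _ => mul_nonneg (Real.exp_pos _).le (h _)

theorem prepend_agree {m : ℕ} {z z' : ℕ → A} (h : ∀ i < m, z i = z' i) (x : A) :
    ∀ i < m + 1, prepend x z i = prepend x z' i := by
  rintro (_ | i) hi
  · rfl
  · exact h i (by omega)

theorem HasTail.antitone (hψ : HasTail ψ t) [Nonempty A] : Antitone t :=
  antitone_nat_of_succ_le fun m => by
    have a : ℕ → A := fun _ => Classical.arbitrary A
    have := hψ.abs_sub_le m a a fun _ _ => rfl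
    simp only [sub_self, abs_zero] at this
    linarith

/-- The basic distortion estimate: a comparison between two functions along sequences that agree in
`m + 1` symbols becomes one along sequences that agree in `m` symbols. -/
theorem HasTail.transfer_le (hψ : HasTail ψ t) {c : ℝ} (hc : 0 ≤ c) {m : ℕ}
    {f g : (ℕ → A) → ℝ} (hg : ∀ x, 0 ≤ g x)
    (h : ∀ x y, (∀ i < m + 1, x i = y i) → f x ≤ c * Real.exp (t (m + 1)) * g y)
    (s : Finset A) (z z' : ℕ → A) (hz : ∀ i < m, z i = z' i) :
    transfer ψ s f z ≤ c * Real.exp (t m) * transfer ψ s g z' := by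
  rw [transfer_apply, transfer_apply, Finset.mul_sum]
  refine Finset.sum_le_sum fun x _ => ?_
  have hx := prepend_agree hz x
  have h1 := (abs_le.mp (hψ.abs_sub_le m _ _ hx)).2
  calc Real.exp (ψ (prepend x z)) * f (prepend x z)
      ≤ (Real.exp (t m - t (m + 1)) * Real.exp (ψ (prepend x z'))) *
          (c * Real.exp (t (m + 1)) * g (prepend x z')) := by
        rw [← Real.exp_add]
        have h2 : 0 ≤ c * Real.exp (t (m + 1)) * g (prepend x z') :=
          mul_nonneg (mul_nonneg hc (Real.exp_pos _).le) (hg _)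
        have h3 : ψ (prepend x z) ≤ t m - t (m + 1) + ψ (prepend x z') := by linarith
        exact (mul_le_mul_of_nonneg_left (h _ _ hx) (Real.exp_pos _).le).trans
          (mul_le_mul_of_nonneg_right (Real.exp_le_exp.mpr h3) h2)
    _ = c * Real.exp (t m) * (Real.exp (ψ (prepend x z')) * g (prepend x z')) := by
        rw [Real.exp_sub]
        field_simp

/-- The iterated distortion estimate; the factor `exp (t m)` does not depend on the number `n` of
operators. -/
theorem HasTail.transferIter_le (hψ : HasTail ψ t) {c : ℝ} (hc : 0 ≤ c) (S : ℕ → Finset A)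
    {n m : ℕ} {f g : (ℕ → A) → ℝ} (hg : ∀ x, 0 ≤ g x)
    (h : ∀ x y, (∀ i < m + n, x i = y i) → f x ≤ c * Real.exp (t (m + n)) * g y)
    (z z' : ℕ → A) (hz : ∀ i < m, z i = z' i) :
    transferIter ψ S n f z ≤ c * Real.exp (t m) * transferIter ψ S n g z' := by
  induction n generalizing m z z' with
  | zero => exact h z z' hz
  | succ n ih =>
    refine hψ.transfer_le hc (transferIter_nonneg S n hg) (fun x y hxy => ?_) _ z z' hz
    exact ih (by rwa [add_right_comm]) x y hxy

theorem IsRegular.transferIter (hψ : HasTail ψ t) (S : ℕ → Finset A) (n : ℕ)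
    {f : (ℕ → A) → ℝ} (hf : IsRegular t f) : IsRegular t (transferIter ψ S n f) where
  nonneg := transferIter_nonneg S n hf.nonneg
  le_exp_mul m x y hxy := by
    simpa using hψ.transferIter_le zero_le_one S hf.nonneg
      (fun x y h => by simpa using hf.le_exp_mul (m + n) x y h) x y hxy

theorem IsRegular.transfer (hψ : HasTail ψ t) (s : Finset A)
    {f : (ℕ → A) → ℝ} (hf : IsRegular t f) : IsRegular t (transfer ψ s f) :=
  hf.transferIter hψ (fun _ => s) 1

theorem IsRegular.smul {f : (ℕ → A) → ℝ} (hf : IsRegular t f) {c : ℝ} (hc : 0 ≤ c) :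
    IsRegular t (c • f) where
  nonneg x := mul_nonneg hc (hf.nonneg x)
  le_exp_mul m x y hxy := by
    have := mul_le_mul_of_nonneg_left (hf.le_exp_mul m x y hxy) hc
    simp only [Pi.smul_apply, smul_eq_mul]
    linarith

theorem isRegular_one (ht : ∀ m, 0 ≤ t m) : IsRegular t (1 : (ℕ → A) → ℝ) where
  nonneg _ := zero_le_one
  le_exp_mul m _ _ _ := by simpa using ht m

theorem IsRegular.le_exp_zero_mul {f : (ℕ → A) → ℝ} (hf : IsRegular t f) (x y : ℕ → A) :
    f x ≤ Real.exp (t 0) * f y :=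
  hf.le_exp_mul 0 x y fun i hi => absurd hi (Nat.not_lt_zero i)

/-! ### Loss of memory -/

/-- The rate of loss of memory after `n` steps in blocks of length `r`: the first term is a
geometric contraction per block, the second the error made by forgetting all symbols beyond the
next `r`. -/
noncomputable def memoryRate (t : ℕ → ℝ) (n r : ℕ) : ℝ :=
  (1 - Real.exp (-(2 * t 0))) ^ (n / r) + 2 * Real.exp (4 * t 0) * t r

variable [Nonempty A]

/-- Block contraction: if the quotient `F / G` of regular functions is at most `1` and lies in an
interval of length `d`, then after `r` further steps the quotient lies in an interval of length
`(1 - κ) d + D`, where `κ = exp (-2 t 0)` and `D` bounds the oscillation of `F / G` on cylinders of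
length `r`. -/
theorem HasTail.osc_block (hψ : HasTail ψ t) {S : ℕ → Finset A} (hS : ∀ i, (S i).Nonempty)
    {F G : (ℕ → A) → ℝ} (hF : IsRegular t F) (hG : IsRegular t G) (hG0 : ∀ z, 0 < G z)
    (hFG : ∀ z, F z ≤ G z) (r : ℕ) {lo d : ℝ} (h1 : ∀ z, lo * G z ≤ F z)
    (h2 : ∀ z, F z ≤ (lo + d) * G z) :
    ∃ lo' : ℝ, ∀ z, lo' * transferIter ψ S r G z ≤ transferIter ψ S r F z ∧
      transferIter ψ S r F z ≤ (lo' + ((1 - Real.exp (-(2 * t 0))) * d +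
        2 * Real.exp (2 * t 0) * t r)) * transferIter ψ S r G z := by
  have htr : t r ≤ t 0 := hψ.antitone (Nat.zero_le r)
  have htr0 := hψ.nonneg r
  set D := 2 * Real.exp (2 * t 0) * t r with hD
  have hD0 : 0 ≤ D := by positivity
  set F' := transferIter ψ S r F with hF'
  set G' := transferIter ψ S r G with hG'
  have hG'0 : ∀ z, 0 < G' z := transferIter_pos hS r hG0
  have hG'r : IsRegular t G' := hG.transferIter hψ S r
  have hF'0 : ∀ z, 0 ≤ F' z := transferIter_nonneg S r hF.nonneg
  -- the quotient `F / G` oscillates by at most `D` on cylinders of length `r`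
  have hosc : ∀ x y, (∀ i < r, x i = y i) → F x / G x ≤ F y / G y + D := by
    intro x y hxy
    have e1 := hF.le_exp_mul r x y hxy
    have e2 := hG.le_exp_mul r y x fun i hi => (hxy i hi).symm
    have hy1 : F y / G y ≤ 1 := (div_le_one (hG0 y)).2 (hFG y)
    have hy0 : 0 ≤ F y / G y := div_nonneg (hF.nonneg y) (hG0 y).le
    have e3 : F x / G x ≤ Real.exp (2 * t r) * (F y / G y) := by
      rw [div_le_iff₀ (hG0 x)]
      have : F y = F y / G y * G y := (div_mul_cancel₀ _ (hG0 y).ne').symm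
      calc F x ≤ Real.exp (t r) * F y := e1
        _ = Real.exp (t r) * (F y / G y * G y) := by rw [← this]
        _ ≤ Real.exp (t r) * (F y / G y * (Real.exp (t r) * G x)) := by gcongr
        _ = Real.exp (2 * t r) * (F y / G y) * G x := by
          rw [two_mul, Real.exp_add]; ring
    have e4 : Real.exp (2 * t r) - 1 ≤ D := by
      have a1 : 1 - 2 * t r ≤ Real.exp (-(2 * t r)) := by
        have := Real.add_one_le_exp (-(2 * t r)); linarith
      have a2 : Real.exp (2 * t r) * Real.exp (-(2 * t r)) = 1 := by
        rw [← Real.exp_add]; simp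
      have a3 : Real.exp (2 * t r) ≤ Real.exp (2 * t 0) := Real.exp_le_exp.2 (by linarith)
      have a4 : Real.exp (2 * t r) * (1 - 2 * t r) ≤ 1 := by
        exact (mul_le_mul_of_nonneg_left a1 (Real.exp_pos _).le).trans a2.le
      have a5 : Real.exp (2 * t r) * (2 * t r) ≤ Real.exp (2 * t 0) * (2 * t r) := by gcongr
      rw [hD]; linarith
    have e5 : (Real.exp (2 * t r) - 1) * (F y / G y) ≤ D * 1 := by gcongr
    linarith
  -- Doeblin comparison of the quotients at any two points
  have key : ∀ z z', F' z' / G' z' - lo ≤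
      Real.exp (2 * t 0) * (F' z / G' z - lo + D) := by
    intro z z'
    have step : ∀ x y, (∀ i < 0 + r, x i = y i) →
        (F - lo • G) x ≤ 1 * Real.exp (t (0 + r)) * (F - (lo - D) • G) y := by
      intro x y hxy
      simp only [zero_add] at hxy
      simp only [Pi.sub_apply, Pi.smul_apply, smul_eq_mul, one_mul, zero_add]
      have e1 := hG.le_exp_mul r x y hxy
      have e2 : F x = F x / G x * G x := (div_mul_cancel₀ _ (hG0 x).ne').symm
      have e3 : F y = F y / G y * G y := (div_mul_cancel₀ _ (hG0 y).ne').symm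
      have e4 : 0 ≤ F x / G x - lo := by
        rw [sub_nonneg, le_div_iff₀ (hG0 x)]; exact h1 x
      have e5 := hosc x y hxy
      calc F x - lo * G x = (F x / G x - lo) * G x := by rw [sub_mul, ← e2]
        _ ≤ (F x / G x - lo) * (Real.exp (t r) * G y) := by gcongr
        _ ≤ (F y / G y + D - lo) * (Real.exp (t r) * G y) := by
          have := (hG0 y).le
          gcongr
        _ = Real.exp (t r) * (F y / G y * G y - (lo - D) * G y) := by ring
        _ = _ := by rw [← e3]
    have hpos : ∀ x, 0 ≤ (F - (lo - D) • G) x := by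
      intro x
      simp only [Pi.sub_apply, Pi.smul_apply, smul_eq_mul]
      have := h1 x
      have := mul_nonneg hD0 (hG0 x).le
      linarith
    have e := hψ.transferIter_le zero_le_one S hpos step z' z
      (fun i hi => absurd hi (Nat.not_lt_zero i))
    simp only [map_sub, map_smul, Pi.sub_apply, Pi.smul_apply, smul_eq_mul, one_mul] at e
    rw [← hF', ← hG'] at e
    have e1 := hG'r.le_exp_zero_mul z z'
    have e2 : 0 ≤ F' z / G' z - lo + D := by
      have : lo * G' z ≤ F' z := by
        have := transferIter_mono (ψ := ψ) S r (f := lo • G) (g := F) h1 z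
        simpa using this
      have : lo ≤ F' z / G' z := by rwa [le_div_iff₀ (hG'0 z)]
      linarith
    have e3 : F' z' - lo * G' z' ≤
        Real.exp (2 * t 0) * (F' z / G' z - lo + D) * G' z' := by
      calc F' z' - lo * G' z' ≤ Real.exp (t 0) * (F' z - (lo - D) * G' z) := e
        _ = Real.exp (t 0) * ((F' z / G' z - lo + D) * G' z) := by
          rw [add_mul, sub_mul (F' z / G' z), div_mul_cancel₀ _ (hG'0 z).ne']; ring
        _ ≤ Real.exp (t 0) * ((F' z / G' z - lo + D) * (Real.exp (t 0) * G' z')) := by gcongr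
        _ = _ := by rw [two_mul, Real.exp_add]; ring
    have e4 : F' z' / G' z' - lo = (F' z' - lo * G' z') / G' z' := by
      rw [sub_div, mul_div_cancel_right₀ _ (hG'0 z').ne']
    rw [e4, div_le_iff₀ (hG'0 z')]
    exact e3
  have hup : ∀ z, F' z / G' z ≤ lo + d := by
    intro z
    rw [div_le_iff₀ (hG'0 z)]
    have := transferIter_mono (ψ := ψ) S r (f := F) (g := (lo + d) • G) h2 z
    simpa using this
  have hbdd : BddBelow (Set.range fun z => F' z / G' z) :=
    ⟨0, by rintro _ ⟨z, rfl⟩; exact div_nonneg (hF'0 z) (hG'0 z).le⟩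
  refine ⟨⨅ z, F' z / G' z, fun z' => ⟨?_, ?_⟩⟩
  · rw [← le_div_iff₀ (hG'0 z')]
    exact ciInf_le hbdd z'
  · rw [← div_le_iff₀ (hG'0 z'), ← sub_le_iff_le_add]
    refine le_ciInf fun z => ?_
    have hk := key z z'
    have hu := hup z'
    have hE : Real.exp (-(2 * t 0)) * Real.exp (2 * t 0) = 1 := by rw [← Real.exp_add]; simp
    have hE1 : Real.exp (-(2 * t 0)) ≤ 1 := by
      rw [Real.exp_le_one_iff]; linarith [hψ.nonneg 0]
    have k1 : Real.exp (-(2 * t 0)) * (F' z' / G' z' - lo) ≤ F' z / G' z - lo + D := by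
      calc _ ≤ Real.exp (-(2 * t 0)) * (Real.exp (2 * t 0) * (F' z / G' z - lo + D)) := by gcongr
        _ = _ := by rw [← mul_assoc, hE, one_mul]
    have k2 : (1 - Real.exp (-(2 * t 0))) * (F' z' / G' z' - lo) ≤
        (1 - Real.exp (-(2 * t 0))) * d := by
      apply mul_le_mul_of_nonneg_left _ (by linarith)
      linarith
    linarith

/-- Loss of memory: the quotient of two regular functions, if bounded by `1`, becomes constant up to
the memory rate after `n` applications of arbitrary restricted transfer operators. -/
theorem HasTail.exists_band (hψ : HasTail ψ t) {S : ℕ → Finset A} (hS : ∀ i, (S i).Nonempty)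
    {f g : (ℕ → A) → ℝ} (hf : IsRegular t f) (hg : IsRegular t g) (hg0 : ∀ z, 0 < g z)
    (hfg : ∀ z, f z ≤ g z) (n r : ℕ) :
    ∃ lo : ℝ, ∀ z, lo * transferIter ψ S n g z ≤ transferIter ψ S n f z ∧
      transferIter ψ S n f z ≤ (lo + memoryRate t n r) * transferIter ψ S n g z := by
  set κ := Real.exp (-(2 * t 0)) with hκ
  have hκ0 : 0 < κ := Real.exp_pos _
  set D := 2 * Real.exp (2 * t 0) * t r with hD
  have main : ∀ j, ∃ lo : ℝ, ∀ z, lo * transferIter ψ S (n % r + j * r) g z ≤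
      transferIter ψ S (n % r + j * r) f z ∧
      transferIter ψ S (n % r + j * r) f z ≤
        (lo + ((1 - κ) ^ j + D / κ)) * transferIter ψ S (n % r + j * r) g z := by
    intro j
    induction j with
    | zero =>
      refine ⟨0, fun z => ⟨?_, ?_⟩⟩
      · rw [zero_mul]; exact transferIter_nonneg S _ hf.nonneg z
      · have h1 : transferIter ψ S (n % r + 0 * r) f z ≤ transferIter ψ S (n % r + 0 * r) g z :=
          transferIter_mono S _ hfg z
        have h2 : 0 ≤ transferIter ψ S (n % r + 0 * r) g z :=
          transferIter_nonneg S _ hg.nonneg z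
        have h3 : 0 ≤ D / κ := by
          have := hψ.nonneg r
          positivity
        have := mul_nonneg h3 h2
        simp only [pow_zero]
        linarith
    | succ j ih =>
      obtain ⟨lo, hlo⟩ := ih
      obtain ⟨lo', hlo'⟩ := hψ.osc_block (S := fun i => S (n % r + j * r + i)) (fun i => hS _)
        (hf.transferIter hψ S (n % r + j * r)) (hg.transferIter hψ S (n % r + j * r))
        (transferIter_pos hS _ hg0) (transferIter_mono S _ hfg) r
        (fun z => (hlo z).1) (fun z => (hlo z).2)
      have he : n % r + (j + 1) * r = n % r + j * r + r := by ring
      have hval : (1 - κ) * ((1 - κ) ^ j + D / κ) + D = (1 - κ) ^ (j + 1) + D / κ := by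
        field_simp; ring
      refine ⟨lo', fun z => ?_⟩
      rw [he, transferIter_add S (n % r + j * r), transferIter_add S (n % r + j * r), ← hval]
      exact hlo' z
  obtain ⟨lo, hlo⟩ := main (n / r)
  have hn : n % r + n / r * r = n := Nat.mod_add_div' n r
  rw [hn] at hlo
  refine ⟨lo, fun z => ?_⟩
  have hval : (1 - κ) ^ (n / r) + D / κ = memoryRate t n r := by
    rw [memoryRate, ← hκ, hD, hκ, Real.exp_neg, div_inv_eq_mul,
      show 4 * t 0 = 2 * t 0 + 2 * t 0 by ring, Real.exp_add]
    ring
  rw [← hval]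
  exact hlo z

end Operators

/-! ### Ratio limits and the eigenfunction -/

section RatioLimit

variable {A : Type*} {ψ : (ℕ → A) → ℝ} {t : ℕ → ℝ}

theorem one_sub_exp_neg_mem (ht : ∀ m, 0 ≤ t m) :
    0 ≤ 1 - Real.exp (-(2 * t 0)) ∧ 1 - Real.exp (-(2 * t 0)) < 1 := by
  have h1 : Real.exp (-(2 * t 0)) ≤ 1 := by
    rw [Real.exp_le_one_iff]
    linarith [ht 0]
  constructor <;> linarith [Real.exp_pos (-(2 * t 0))]

theorem memoryRate_nonneg (ht : ∀ m, 0 ≤ t m) (n r : ℕ) : 0 ≤ memoryRate t n r := by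
  have h1 := (one_sub_exp_neg_mem ht).1
  have h2 := ht r
  unfold memoryRate
  positivity

theorem tendsto_memoryRate_sqrt (ht : ∀ m, 0 ≤ t m) (ht0 : Tendsto t atTop (𝓝 0)) :
    Tendsto (fun n => memoryRate t n (Nat.sqrt n)) atTop (𝓝 0) := by
  have hs : Tendsto Nat.sqrt atTop atTop :=
    tendsto_atTop.2 fun b => (eventually_ge_atTop (b * b)).mono fun n hn => Nat.le_sqrt.2 hn
  have hd : Tendsto (fun n => n / Nat.sqrt n) atTop atTop := by
    refine tendsto_atTop_mono' _ ?_ hs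
    filter_upwards [eventually_ge_atTop 1] with n hn
    rw [Nat.le_div_iff_mul_le (Nat.sqrt_pos.2 hn)]
    exact Nat.sqrt_le n
  have h := one_sub_exp_neg_mem ht
  have h1 := (tendsto_pow_atTop_nhds_zero_of_lt_one h.1 h.2).comp hd
  have h2 := (ht0.comp hs).const_mul (2 * Real.exp (4 * t 0))
  simpa [memoryRate, Function.comp_def] using h1.add h2

section Eigen

variable [Fintype A]

/-- The unrestricted iterated transfer operator. -/
noncomputable abbrev fullIter (ψ : (ℕ → A) → ℝ) (n : ℕ) :
    ((ℕ → A) → ℝ) →ₗ[ℝ] ((ℕ → A) → ℝ) :=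
  transferIter ψ (fun _ => Finset.univ) n

theorem fullIter_add (m n : ℕ) (f : (ℕ → A) → ℝ) :
    fullIter ψ (m + n) f = fullIter ψ n (fullIter ψ m f) := transferIter_add _ m n f

/-- An eigenvalue `l` and a positive regular eigenfunction `h` of the transfer operator of `ψ`,
together with the rate at which `l ^ (-n) L^n 1` converges to `h`. -/
structure IsEigen (ψ : (ℕ → A) → ℝ) (t : ℕ → ℝ) (l : ℝ) (h : (ℕ → A) → ℝ) : Prop where
  eigenvalue_pos : 0 < l
  regular : IsRegular t h
  pos : ∀ z, 0 < h z
  eigen : transfer ψ Finset.univ h = l • h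
  approx : ∀ n r z, |h z - (l ^ n)⁻¹ * fullIter ψ n 1 z| ≤
    Real.exp (t 0) * memoryRate t n r * ((l ^ n)⁻¹ * fullIter ψ n 1 z)

theorem transferIter_le_fullIter (S : ℕ → Finset A) (n : ℕ) {f : (ℕ → A) → ℝ}
    (hf : ∀ z, 0 ≤ f z) : transferIter ψ S n f ≤ fullIter ψ n f := by
  induction n with
  | zero => exact le_rfl
  | succ n ih =>
    rw [fullIter, transferIter_succ, transferIter_succ]
    exact (transfer_le_univ _ (transferIter_nonneg S n hf)).trans (transfer_mono _ ih)

theorem IsEigen.fullIter_eq {l : ℝ} {h : (ℕ → A) → ℝ} (H : IsEigen ψ t l h) (n : ℕ) :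
    fullIter ψ n h = l ^ n • h := by
  induction n with
  | zero => simp [fullIter, transferIter_zero]
  | succ n ih =>
    rw [fullIter, transferIter_succ, ih, map_smul, H.eigen, smul_smul, pow_succ]

theorem IsEigen.transferIter_le {l : ℝ} {h : (ℕ → A) → ℝ} (H : IsEigen ψ t l h)
    (S : ℕ → Finset A) (n : ℕ) (z : ℕ → A) : transferIter ψ S n h z ≤ l ^ n * h z := by
  have := transferIter_le_fullIter (ψ := ψ) S n H.regular.nonneg z
  rwa [H.fullIter_eq] at this

end Eigen

variable [Nonempty A]

/-- The quotient of two regular functions under iterated restricted transfer operators converges,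
uniformly and at the memory rate, to a constant. -/
theorem HasTail.exists_ratio_limit (hψ : HasTail ψ t) (ht0 : Tendsto t atTop (𝓝 0))
    {S : ℕ → Finset A} (hS : ∀ i, (S i).Nonempty)
    {f g : (ℕ → A) → ℝ} (hf : IsRegular t f) (hg : IsRegular t g) (hg0 : ∀ z, 0 < g z)
    {U : ℝ} (hU : 0 < U) (hfg : ∀ z, f z ≤ U * g z) :
    ∃ l : ℝ, (∀ z, Tendsto (fun n => transferIter ψ S n f z / transferIter ψ S n g z)
      atTop (𝓝 l)) ∧
      ∀ m n r z, n ≤ m → |transferIter ψ S m f z / transferIter ψ S m g z - l| ≤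
        U * memoryRate t n r := by
  have hpos : ∀ n z, 0 < transferIter ψ S n g z := fun n => transferIter_pos hS n hg0
  have band : ∀ n r, ∃ lo : ℝ, ∀ m z, n ≤ m →
      lo ≤ transferIter ψ S m f z / transferIter ψ S m g z ∧
      transferIter ψ S m f z / transferIter ψ S m g z ≤ lo + U * memoryRate t n r := by
    intro n r
    obtain ⟨lo, hlo⟩ := hψ.exists_band hS (hf.smul (c := U⁻¹) (by positivity)) hg hg0
      (fun z => by
        simp only [Pi.smul_apply, smul_eq_mul]
        rw [inv_mul_le_iff₀ hU]
        exact hfg z) n r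
    have h1 : (U * lo) • transferIter ψ S n g ≤ transferIter ψ S n f := by
      intro z
      have := (hlo z).1
      simp only [map_smul, Pi.smul_apply, smul_eq_mul] at this ⊢
      rw [le_inv_mul_iff₀ hU] at this
      linarith
    have h2 : transferIter ψ S n f ≤
        (U * lo + U * memoryRate t n r) • transferIter ψ S n g := by
      intro z
      have := (hlo z).2
      simp only [map_smul, Pi.smul_apply, smul_eq_mul] at this ⊢
      rw [inv_mul_le_iff₀ hU] at this
      linarith
    refine ⟨U * lo, fun m z hm => ?_⟩
    obtain ⟨k, rfl⟩ := Nat.exists_eq_add_of_le hm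
    rw [le_div_iff₀ (hpos _ z), div_le_iff₀ (hpos _ z)]
    simp only [transferIter_add S n k]
    have e1 := transferIter_mono (ψ := ψ) (fun i => S (n + i)) k h1 z
    have e2 := transferIter_mono (ψ := ψ) (fun i => S (n + i)) k h2 z
    simp only [map_smul, Pi.smul_apply, smul_eq_mul] at e1 e2
    exact ⟨e1, e2⟩
  have hdist : ∀ n r m m' z z', n ≤ m → n ≤ m' →
      |transferIter ψ S m f z / transferIter ψ S m g z -
        transferIter ψ S m' f z' / transferIter ψ S m' g z'| ≤ U * memoryRate t n r := by
    intro n r m m' z z' hm hm'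
    obtain ⟨lo, hlo⟩ := band n r
    have e1 := hlo m z hm
    have e2 := hlo m' z' hm'
    rw [abs_le]
    constructor <;> linarith [e1.1, e1.2, e2.1, e2.2]
  have a : ℕ → A := fun _ => Classical.arbitrary A
  have hrate : Tendsto (fun n => U * memoryRate t n (Nat.sqrt n)) atTop (𝓝 0) := by
    simpa using (tendsto_memoryRate_sqrt hψ.nonneg ht0).const_mul U
  obtain ⟨l, hl⟩ := cauchySeq_tendsto_of_complete
    (cauchySeq_of_le_tendsto_0 (s := fun n => transferIter ψ S n f a / transferIter ψ S n g a)
      (fun n => U * memoryRate t n (Nat.sqrt n))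
      (fun m m' n hm hm' => by
        rw [Real.dist_eq]; exact hdist n _ m m' a a hm hm') hrate)
  have hb : ∀ m n r z, n ≤ m → |transferIter ψ S m f z / transferIter ψ S m g z - l| ≤
        U * memoryRate t n r := by
    intro m n r z hm
    refine le_of_tendsto ((tendsto_const_nhds.sub hl).abs) ?_
    filter_upwards [eventually_ge_atTop n] with m' hm'
    exact hdist n r m m' z a hm hm'
  refine ⟨l, fun z => ?_, hb⟩
  rw [tendsto_iff_dist_tendsto_zero]
  refine squeeze_zero (fun _ => dist_nonneg) (fun n => ?_) hrate
  rw [Real.dist_eq]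
  exact hb n n _ z le_rfl

theorem HasTail.exists_isEigen [Fintype A] (hψ : HasTail ψ t) (ht0 : Tendsto t atTop (𝓝 0)) :
    ∃ l h, IsEigen ψ t l h := by
  have a : ℕ → A := fun _ => Classical.arbitrary A
  have hU : ∀ i : ℕ, ((fun _ => Finset.univ : ℕ → Finset A) i).Nonempty :=
    fun _ => Finset.univ_nonempty
  have hone : IsRegular t (1 : (ℕ → A) → ℝ) := isRegular_one hψ.nonneg
  have hone0 : ∀ z : ℕ → A, (0 : ℝ) < (1 : (ℕ → A) → ℝ) z := fun _ => zero_lt_one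
  have hreg : ∀ k, IsRegular t (fullIter ψ k 1) := fun k => hone.transferIter hψ _ k
  have hpos : ∀ k z, 0 < fullIter ψ k 1 z := fun k => transferIter_pos hU k hone0
  have hbd : ∀ k z, fullIter ψ k 1 z ≤
      (Real.exp (t 0) * fullIter ψ k 1 a) * (1 : (ℕ → A) → ℝ) z := fun k z => by
    simpa using (hreg k).le_exp_zero_mul z a
  have hbd0 : ∀ k, 0 < Real.exp (t 0) * fullIter ψ k 1 a := fun k =>
    mul_pos (Real.exp_pos _) (hpos k a)
  obtain ⟨l, hl, -⟩ := hψ.exists_ratio_limit ht0 hU (hreg 1) hone hone0 (hbd0 1) (hbd 1)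
  -- `L^(n+k) 1 / L^n 1` converges to `l ^ k`
  have hlim : ∀ k z, Tendsto (fun n => fullIter ψ n (fullIter ψ k 1) z / fullIter ψ n 1 z)
      atTop (𝓝 (l ^ k)) := by
    intro k z
    induction k with
    | zero =>
      refine tendsto_const_nhds.congr fun n => ?_
      rw [pow_zero]
      exact (div_self (hpos n z).ne').symm
    | succ k ih =>
      have h1 := ((tendsto_add_atTop_iff_nat 1).2 ih).mul (hl z)
      rw [← pow_succ] at h1
      refine h1.congr fun n => ?_
      have e1 : transferIter ψ (fun _ => Finset.univ) n (fullIter ψ 1 1) z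
          = fullIter ψ (n + 1) 1 z := by rw [add_comm, fullIter_add]
      have e2 : fullIter ψ n (fullIter ψ (k + 1) 1) = fullIter ψ (n + 1) (fullIter ψ k 1) := by
        rw [← fullIter_add, ← fullIter_add]
        congr 2
        ring
      rw [e1, e2]
      exact div_mul_div_cancel₀ (hpos (n + 1) z).ne'
  have hle : ∀ k z, fullIter ψ k 1 z ≤ Real.exp (t 0) * l ^ k := by
    intro k z
    have hc : (Real.exp (-t 0) * fullIter ψ k 1 z) • (1 : (ℕ → A) → ℝ) ≤ fullIter ψ k 1 := by
      intro y
      have := (hreg k).le_exp_zero_mul z y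
      simp only [Pi.smul_apply, Pi.one_apply, smul_eq_mul, mul_one]
      rw [Real.exp_neg, inv_mul_le_iff₀ (Real.exp_pos _)]
      exact this
    have : Real.exp (-t 0) * fullIter ψ k 1 z ≤ l ^ k := by
      refine ge_of_tendsto' (hlim k z) fun n => ?_
      rw [le_div_iff₀ (hpos n z)]
      simpa using transferIter_mono (ψ := ψ) (fun _ => Finset.univ) n hc z
    rwa [Real.exp_neg, inv_mul_le_iff₀ (Real.exp_pos _)] at this
  have hl0 : 0 < l := by
    have := hle 1 a
    rw [pow_one] at this
    exact pos_of_mul_pos_right ((hpos 1 a).trans_le this) (Real.exp_pos _).le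
  set H : ℕ → (ℕ → A) → ℝ := fun n z => (l ^ n)⁻¹ * fullIter ψ n 1 z with hH
  have hH0 : ∀ n z, 0 < H n z := fun n z => mul_pos (inv_pos.2 (pow_pos hl0 n)) (hpos n z)
  have hHreg : ∀ n, IsRegular t (H n) := fun n => (hreg n).smul (inv_nonneg.2 (pow_pos hl0 n).le)
  have hHle : ∀ n z, H n z ≤ Real.exp (t 0) := by
    intro n z
    rw [hH]
    simp only
    rw [inv_mul_le_iff₀ (pow_pos hl0 n), mul_comm]
    exact hle n z
  have hHge : ∀ n z, Real.exp (-t 0) ≤ H n z := by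
    intro n z
    have hc : fullIter ψ n 1 ≤ (Real.exp (t 0) * fullIter ψ n 1 z) • (1 : (ℕ → A) → ℝ) := by
      intro y
      simpa using (hreg n).le_exp_zero_mul y z
    have : l ^ n ≤ Real.exp (t 0) * fullIter ψ n 1 z := by
      refine le_of_tendsto' (hlim n z) fun m => ?_
      rw [div_le_iff₀ (hpos m z)]
      simpa using transferIter_mono (ψ := ψ) (fun _ => Finset.univ) m hc z
    rw [hH]
    simp only
    rw [Real.exp_neg, le_inv_mul_iff₀ (pow_pos hl0 n), mul_inv_le_iff₀ (Real.exp_pos _), mul_comm]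
    exact this
  have hHdist : ∀ n k r z, |H (n + k) z - H n z| ≤
      Real.exp (t 0) * memoryRate t n r * H n z := by
    intro n k r z
    obtain ⟨l', hl', hb⟩ := hψ.exists_ratio_limit ht0 hU (hreg k) hone hone0
      (mul_pos (Real.exp_pos (t 0)) (pow_pos hl0 k)) (fun z => by simpa using hle k z)
    have : l' = l ^ k := tendsto_nhds_unique (hl' z) (hlim k z)
    subst this
    have hb := hb n n r z le_rfl
    have e : H (n + k) z - H n z = (fullIter ψ n (fullIter ψ k 1) z / fullIter ψ n 1 z - l ^ k)
        * ((l ^ k)⁻¹ * H n z) := by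
      have := (hpos n z).ne'
      rw [hH]
      simp only
      rw [add_comm n k, fullIter_add, pow_add]
      field_simp
    rw [e, abs_mul, abs_of_pos (mul_pos (inv_pos.2 (pow_pos hl0 k)) (hH0 n z))]
    calc _ ≤ (Real.exp (t 0) * l ^ k * memoryRate t n r) * ((l ^ k)⁻¹ * H n z) :=
          mul_le_mul_of_nonneg_right hb (mul_pos (inv_pos.2 (pow_pos hl0 k)) (hH0 n z)).le
      _ = _ := by
        have := (pow_pos hl0 k).ne'
        field_simp
  have hrate : Tendsto (fun n => Real.exp (t 0) * Real.exp (t 0) *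
      memoryRate t n (Nat.sqrt n) * 2) atTop (𝓝 0) := by
    simpa using ((tendsto_memoryRate_sqrt hψ.nonneg ht0).const_mul
      (Real.exp (t 0) * Real.exp (t 0))).mul_const 2
  have hlimH : ∀ z, ∃ y, Tendsto (fun n => H n z) atTop (𝓝 y) := by
    intro z
    refine cauchySeq_tendsto_of_complete (cauchySeq_of_le_tendsto_0 _ (fun m m' n hm hm' => ?_)
      hrate)
    obtain ⟨k, rfl⟩ := Nat.exists_eq_add_of_le hm
    obtain ⟨k', rfl⟩ := Nat.exists_eq_add_of_le hm'
    have e : Real.exp (t 0) * memoryRate t n (Nat.sqrt n) * H n z ≤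
        Real.exp (t 0) * memoryRate t n (Nat.sqrt n) * Real.exp (t 0) :=
      mul_le_mul_of_nonneg_left (hHle n z)
        (mul_nonneg (Real.exp_pos _).le (memoryRate_nonneg hψ.nonneg _ _))
    have e1 := abs_le.1 (hHdist n k (Nat.sqrt n) z)
    have e2 := abs_le.1 (hHdist n k' (Nat.sqrt n) z)
    rw [Real.dist_eq, abs_le]
    constructor <;> linarith [e1.1, e1.2, e2.1, e2.2]
  choose h hh using hlimH
  refine ⟨l, h, hl0, ⟨fun x => ?_, fun m x y hxy => ?_⟩, fun z => ?_, ?_, fun n r z => ?_⟩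
  · exact ge_of_tendsto' (hh x) fun n => (hH0 n x).le
  · exact le_of_tendsto_of_tendsto' (hh x) ((hh y).const_mul _)
      fun n => (hHreg n).le_exp_mul m x y hxy
  · exact (Real.exp_pos (-t 0)).trans_le (ge_of_tendsto' (hh z) fun n => hHge n z)
  · ext z
    have h1 : Tendsto (fun n => transfer ψ Finset.univ (H n) z) atTop
        (𝓝 (transfer ψ Finset.univ h z)) :=
      tendsto_finsetSum _ fun x _ => (hh (prepend x z)).const_mul _
    have h2 : Tendsto (fun n => transfer ψ Finset.univ (H n) z) atTop (𝓝 (l * h z)) := by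
      refine (((tendsto_add_atTop_iff_nat 1).2 (hh z)).const_mul l).congr fun n => ?_
      have : H n = (l ^ n)⁻¹ • fullIter ψ n 1 := rfl
      rw [this, map_smul, hH, Pi.smul_apply, smul_eq_mul]
      simp only
      rw [fullIter, transferIter_succ, pow_succ]
      field_simp
    exact tendsto_nhds_unique h1 h2
  · refine le_of_tendsto (((hh z).sub_const _).abs) ?_
    filter_upwards [eventually_ge_atTop n] with m hm
    obtain ⟨k, rfl⟩ := Nat.exists_eq_add_of_le hm
    exact hHdist n k r z

end RatioLimit

/-! ### Construction of the measure -/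

/-- The sequences `x` with `x_i ∈ S i` for `i < n`. -/
def cylSet {A : Type*} (S : ℕ → Finset A) (n : ℕ) : Set (ℕ → A) := {x | ∀ i < n, x i ∈ S i}

section CylSet

variable {A : Type*} {ψ : (ℕ → A) → ℝ} {t : ℕ → ℝ}

theorem mem_cylSet_succ {S : ℕ → Finset A} {n : ℕ} {x : A} {z : ℕ → A} :
    prepend x z ∈ cylSet S (n + 1) ↔ x ∈ S 0 ∧ z ∈ cylSet (fun i => S (i + 1)) n := by
  constructor
  · exact fun h => ⟨h 0 (by omega), fun i hi => h (i + 1) (by omega)⟩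
  · rintro ⟨h0, h⟩ (_ | i) hi
    · exact h0
    · exact h i (by omega)

theorem isClopen_cylSet [TopologicalSpace A] [DiscreteTopology A] (S : ℕ → Finset A) (n : ℕ) :
    IsClopen (cylSet S n) := by
  have : cylSet S n = ⋂ i ∈ Finset.range n, (fun x : ℕ → A => x i) ⁻¹' (S i : Set A) := by
    ext x
    simp [cylSet]
  rw [this]
  exact (isClopen_biInter_finset fun i _ => (isClopen_discrete _).preimage (continuous_apply i))

theorem measurableSet_cylSet [MeasurableSpace A] [DiscreteMeasurableSpace A] (S : ℕ → Finset A)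
    (n : ℕ) : MeasurableSet (cylSet S n) := by
  have : cylSet S n = ⋂ i ∈ Finset.range n, (fun x : ℕ → A => x i) ⁻¹' (S i : Set A) := by
    ext x
    simp [cylSet]
  rw [this]
  exact Finset.measurableSet_biInter _ fun i _ => measurable_pi_apply i (MeasurableSet.of_discrete)

open Classical in
/-- Restricting the symbols in the operators amounts to restricting the function to a cylinder. -/
theorem fullIter_indicator_cylSet [Fintype A] (S : ℕ → Finset A) (n : ℕ) (f : (ℕ → A) → ℝ) :
    fullIter ψ n ((cylSet S n).indicator f) = transferIter ψ S n f := by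
  induction n generalizing S f with
  | zero =>
    have : cylSet S 0 = Set.univ := by ext; simp [cylSet]
    rw [this, Set.indicator_univ]
    rfl
  | succ n ih =>
    rw [fullIter, transferIter_succ', transferIter_succ', ← ih fun i => S (i + 1)]
    refine congrArg (fullIter ψ n) (funext fun z => ?_)
    simp only [transfer_apply, Set.indicator_apply, mem_cylSet_succ]
    by_cases hz : z ∈ cylSet (fun i => S (i + 1)) n
    · simp [hz, Finset.sum_ite_mem]
    · simp only [hz, and_false, if_false, mul_zero, Finset.sum_const_zero]

end CylSet

section PathMeasure

variable {A : Type*} [Fintype A] [MeasurableSpace A] {ψ : (ℕ → A) → ℝ} {t : ℕ → ℝ}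

/-- The law of the sequence obtained from `z` by prepending `n` random symbols, the transition
probability from `z` to `x z` being `exp (ψ (x z)) h (x z) / (l h z)`. -/
noncomputable def pathMeasure (ψ : (ℕ → A) → ℝ) (l : ℝ) (h : (ℕ → A) → ℝ) :
    ℕ → (ℕ → A) → Measure (ℕ → A)
  | 0, z => Measure.dirac z
  | n + 1, z => ∑ x, ENNReal.ofReal (Real.exp (ψ (prepend x z)) * h (prepend x z) / (l * h z)) •
      pathMeasure ψ l h n (prepend x z)

theorem IsEigen.pathMeasure_apply {l : ℝ} {h : (ℕ → A) → ℝ} (H : IsEigen ψ t l h) (n : ℕ)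
    (z : ℕ → A) {E : Set (ℕ → A)} (hE : MeasurableSet E) :
    pathMeasure ψ l h n z E =
      ENNReal.ofReal (fullIter ψ n (E.indicator h) z / (l ^ n * h z)) := by
  have hind : 0 ≤ E.indicator h := Set.indicator_nonneg fun x _ => (H.pos x).le
  induction n generalizing z with
  | zero =>
    rw [pathMeasure, Measure.dirac_apply' _ hE, fullIter, transferIter_zero]
    by_cases hz : z ∈ E
    · simp [hz, div_self (H.pos z).ne']
    · simp [hz]
  | succ n ih =>
    rw [pathMeasure, Measure.finsetSum_apply]
    simp only [Measure.smul_apply, smul_eq_mul, ih]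
    have hl := H.eigenvalue_pos
    have hp : ∀ x : A, 0 ≤ Real.exp (ψ (prepend x z)) * h (prepend x z) / (l * h z) := fun x =>
      div_nonneg (mul_nonneg (Real.exp_pos _).le (H.pos _).le) (mul_pos hl (H.pos z)).le
    have hq : ∀ x : A, 0 ≤ fullIter ψ n (E.indicator h) (prepend x z) /
        (l ^ n * h (prepend x z)) := fun x =>
      div_nonneg (transferIter_nonneg _ n hind _) (mul_pos (pow_pos hl n) (H.pos _)).le
    simp only [← ENNReal.ofReal_mul (hp _)]
    rw [← ENNReal.ofReal_sum_of_nonneg fun x _ => mul_nonneg (hp x) (hq x)]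
    congr 1
    rw [fullIter, transferIter_succ, transfer_apply, Finset.sum_div]
    refine Finset.sum_congr rfl fun x _ => ?_
    have h1 := (H.pos z).ne'
    have h2 := (H.pos (prepend x z)).ne'
    rw [pow_succ]
    field_simp

theorem IsEigen.isProbabilityMeasure_pathMeasure {l : ℝ} {h : (ℕ → A) → ℝ}
    (H : IsEigen ψ t l h) (n : ℕ) (z : ℕ → A) : IsProbabilityMeasure (pathMeasure ψ l h n z) := by
  constructor
  rw [H.pathMeasure_apply n z MeasurableSet.univ, Set.indicator_univ, H.fullIter_eq, Pi.smul_apply,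
    smul_eq_mul, div_self (mul_pos (pow_pos H.eigenvalue_pos n) (H.pos z)).ne', ENNReal.ofReal_one]

/-- `μ` is compatible with the eigendata `(l, h)`: its mass on a set `cylSet S n` is the limit of
the quotients of `L^k L_{S (n-1)} ⋯ L_{S 0} h` and `L^k h`, up to the factor `l ^ n`. -/
def IsCompatible (ψ : (ℕ → A) → ℝ) (l : ℝ) (h : (ℕ → A) → ℝ) (μ : Measure (ℕ → A)) : Prop :=
  ∀ (S : ℕ → Finset A) (n : ℕ) (z : ℕ → A), Tendsto
    (fun k => fullIter ψ k (transferIter ψ S n h) z / fullIter ψ k h z) atTop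
    (𝓝 (l ^ n * μ.real (cylSet S n)))

/-- Comparisons between the functions `L_{S (n-1)} ⋯ L_{S 0} h` pass to the measures of the
corresponding sets `cylSet S n`. -/
theorem IsCompatible.le_mul [Nonempty A] {l : ℝ} {h : (ℕ → A) → ℝ} {μ : Measure (ℕ → A)}
    (hμ : IsCompatible ψ l h μ) (hh : ∀ z, 0 ≤ h z) {S S' : ℕ → Finset A} {n n' : ℕ} {c : ℝ}
    (hc : ∀ z, transferIter ψ S' n' h z ≤ c * transferIter ψ S n h z) :
    l ^ n' * μ.real (cylSet S' n') ≤ c * (l ^ n * μ.real (cylSet S n)) := by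
  have a : ℕ → A := fun _ => Classical.arbitrary A
  refine le_of_tendsto_of_tendsto' (hμ S' n' a) ((hμ S n a).const_mul c) fun k => ?_
  rw [← mul_div_assoc]
  refine div_le_div_of_nonneg_right ?_ (transferIter_nonneg _ _ hh a)
  simpa using transferIter_mono (ψ := ψ) (fun _ => Finset.univ) k
    (g := c • transferIter ψ S n h) hc a

theorem IsEigen.exists_isCompatible [DiscreteMeasurableSpace A] [TopologicalSpace A]
    [DiscreteTopology A] [Nonempty A] (hψ : HasTail ψ t) (ht0 : Tendsto t atTop (𝓝 0))
    {l : ℝ} {h : (ℕ → A) → ℝ} (H : IsEigen ψ t l h) :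
    ∃ μ : Measure (ℕ → A), IsProbabilityMeasure μ ∧ IsCompatible ψ l h μ := by
  have a : ℕ → A := fun _ => Classical.arbitrary A
  let P : ℕ → ProbabilityMeasure (ℕ → A) := fun n =>
    ⟨pathMeasure ψ l h n a, H.isProbabilityMeasure_pathMeasure n a⟩
  let F : Ultrafilter (ProbabilityMeasure (ℕ → A)) := (hyperfilter ℕ).map P
  have hF : Tendsto P (hyperfilter ℕ) (𝓝 F.lim) := F.le_nhds_lim
  refine ⟨F.lim, inferInstance, fun S n z => ?_⟩
  have hl := H.eigenvalue_pos
  have hlim : ∀ (S : ℕ → Finset A) (n : ℕ), Tendsto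
      (fun k => (pathMeasure ψ l h k a).real (cylSet S n)) (hyperfilter ℕ)
      (𝓝 ((F.lim : Measure (ℕ → A)).real (cylSet S n))) := fun S n =>
    (NNReal.continuous_coe.tendsto _).comp
      (ProbabilityMeasure.tendsto_measure_of_isClopen_of_tendsto hF (isClopen_cylSet S n))
  have hval : ∀ (S : ℕ → Finset A) (n k : ℕ), n ≤ k →
      l ^ n * (pathMeasure ψ l h k a).real (cylSet S n) =
        fullIter ψ (k - n) (transferIter ψ S n h) a / (l ^ (k - n) * h a) := by
    intro S n k hk
    obtain ⟨j, rfl⟩ := Nat.exists_eq_add_of_le hk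
    have hind : 0 ≤ (cylSet S n).indicator h := Set.indicator_nonneg fun x _ => (H.pos x).le
    rw [measureReal_def, H.pathMeasure_apply _ _ (measurableSet_cylSet S n), ENNReal.toReal_ofReal
      (div_nonneg (transferIter_nonneg _ _ hind _) (mul_pos (pow_pos hl _) (H.pos _)).le),
      fullIter_add, fullIter_indicator_cylSet, Nat.add_sub_cancel_left, pow_add]
    have h1 := (H.pos a).ne'
    field_simp
  -- loss of memory makes the quotients converge along the whole sequence, to a limit that does not
  -- depend on the end point
  obtain ⟨y, hy, -⟩ := hψ.exists_ratio_limit ht0 (fun _ => Finset.univ_nonempty)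
    (H.regular.transferIter hψ S n) H.regular H.pos (pow_pos hl n) (H.transferIter_le S n)
  have hy' : Tendsto (fun k => l ^ n * (pathMeasure ψ l h k a).real (cylSet S n)) atTop
      (𝓝 y) := by
    rw [← tendsto_add_atTop_iff_nat n]
    refine (hy a).congr fun k => ?_
    rw [hval S n (k + n) (Nat.le_add_left n k), Nat.add_sub_cancel, H.fullIter_eq]
    rfl
  rw [← tendsto_nhds_unique (hy'.mono_left Nat.hyperfilter_le_atTop) ((hlim S n).const_mul _)]
  exact hy z

end PathMeasure

/-! ### Cylinders -/

section Cylinders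

variable {A : Type*}

theorem mem_cyl_zero {a x : ℕ → A} {n : ℕ} : x ∈ cyl a 0 n ↔ ∀ i < n + 1, x i = a i := by
  simp [cyl]

theorem cyl_zero_eq_cylSet (a : ℕ → A) (n : ℕ) :
    cyl a 0 n = cylSet (fun i => {a i}) (n + 1) := by
  ext x
  simp [mem_cyl_zero, cylSet]

theorem self_mem_cyl_zero (a : ℕ → A) (n : ℕ) : a ∈ cyl a 0 n :=
  mem_cyl_zero.2 fun _ _ => rfl

theorem shift_iterate (n : ℕ) (a : ℕ → A) : shift^[n] a = fun i => a (i + n) := by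
  induction n with
  | zero => rfl
  | succ n ih =>
    rw [Function.iterate_succ_apply', ih]
    ext i
    simp only [shift]
    congr 1
    ring

theorem measurableSet_cyl [MeasurableSpace A] [DiscreteMeasurableSpace A] (a : ℕ → A) (n : ℕ) :
    MeasurableSet (cyl a 0 n) := by
  rw [cyl_zero_eq_cylSet]
  exact measurableSet_cylSet _ _

theorem measurable_shift [MeasurableSpace A] : Measurable (shift (A := A)) :=
  measurable_pi_lambda _ fun n => measurable_pi_apply (n + 1)

theorem measure_preimage_le_of_cyl [MeasurableSpace A] [DiscreteMeasurableSpace A] [Fintype A]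
    {μ ν : Measure (ℕ → A)} {n : ℕ}
    (h : ∀ a, μ (cyl a 0 n) ≤ ν (cyl a 0 n)) (W : Set (Fin (n + 1) → A)) :
    μ ((fun (x : ℕ → A) (i : Fin (n + 1)) => x i) ⁻¹' W) ≤
      ν ((fun (x : ℕ → A) (i : Fin (n + 1)) => x i) ⁻¹' W) := by
  have hpre : ∀ w : Fin (n + 1) → A, ((fun (x : ℕ → A) (i : Fin (n + 1)) => x i) ⁻¹' {w}) =
      cyl (fun i => w ⟨min i n, by omega⟩) 0 n := by
    intro w
    ext x
    rw [mem_cyl_zero, Set.mem_preimage, Set.mem_singleton_iff, funext_iff]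
    constructor
    · intro hx i hi
      rw [hx ⟨i, hi⟩]
      congr 2
      omega
    · rintro hx ⟨i, hi⟩
      rw [hx i hi]
      congr 2
      omega
  have hW := W.toFinite.coe_toFinset
  rw [← hW, ← sum_measure_preimage_singleton, ← sum_measure_preimage_singleton]
  · refine Finset.sum_le_sum fun w _ => ?_
    rw [hpre]
    exact h _
  all_goals
    intro w _
    rw [hpre]
    exact measurableSet_cyl _ _

theorem measure_univ_le_of_cyl [MeasurableSpace A] [DiscreteMeasurableSpace A] [Fintype A]
    {μ ν : Measure (ℕ → A)} {n : ℕ}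
    (h : ∀ a, μ (cyl a 0 n) ≤ ν (cyl a 0 n)) : μ Set.univ ≤ ν Set.univ := by
  simpa using measure_preimage_le_of_cyl h Set.univ

variable [TopologicalSpace A] [DiscreteTopology A]

theorem exists_cyl_subset {U : Set (ℕ → A)} (hU : IsOpen U) {x : ℕ → A} (hx : x ∈ U) :
    ∃ n, cyl x 0 n ⊆ U := by
  obtain ⟨_, ⟨y, n, rfl⟩, hxy, hyU⟩ :=
    (PiNat.isTopologicalBasis_cylinders (fun _ : ℕ => A)).exists_subset_of_mem_open hx hU
  refine ⟨n, fun z hz => hyU fun i hi => ?_⟩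
  rw [mem_cyl_zero.1 hz i (by omega)]
  exact hxy i hi

theorem isOpen_cyl (a : ℕ → A) (n : ℕ) : IsOpen (cyl a 0 n) := by
  rw [cyl_zero_eq_cylSet]
  exact (isClopen_cylSet _ _).isOpen

theorem continuous_of_abs_sub_le {f : (ℕ → A) → ℝ} {w : ℕ → ℝ} (hw : Tendsto w atTop (𝓝 0))
    (h : ∀ m x y, (∀ i < m + 1, x i = y i) → |f x - f y| ≤ w m) : Continuous f := by
  rw [continuous_iff_continuousAt]
  intro x
  rw [ContinuousAt, Metric.tendsto_nhds]
  intro ε hε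
  obtain ⟨m, hm⟩ := (hw.eventually (gt_mem_nhds hε)).exists
  filter_upwards [(isOpen_cyl x m).mem_nhds (self_mem_cyl_zero x m)] with y hy
  rw [Real.dist_eq]
  exact (h m y x (mem_cyl_zero.1 hy)).trans_lt hm

variable [MeasurableSpace A] [DiscreteMeasurableSpace A]

variable [Fintype A]

/-- An inequality between finite measures holds on all Borel sets once it holds on cylinders: open
sets are increasing unions of finite unions of cylinders of equal length, and finite measures are
outer regular. -/
theorem measure_le_of_cyl {μ ν : Measure (ℕ → A)} [IsFiniteMeasure ν]
    (h : ∀ a n, μ (cyl a 0 n) ≤ ν (cyl a 0 n)) : μ ≤ ν := by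
  have hopen : ∀ U : Set (ℕ → A), IsOpen U → μ U ≤ ν U := by
    intro U hU
    let V : ℕ → Set (ℕ → A) := fun n => {x | cyl x 0 n ⊆ U}
    have hV : U = ⋃ n, V n := by
      ext x
      rw [Set.mem_iUnion]
      exact ⟨fun hx => exists_cyl_subset hU hx, fun ⟨n, hn⟩ => hn (self_mem_cyl_zero x n)⟩
    have hmono : Monotone V := by
      intro m n hmn x hx y hy
      refine hx (mem_cyl_zero.2 fun i hi => mem_cyl_zero.1 hy i (by omega))
    have hsat : ∀ n, V n = (fun (x : ℕ → A) (i : Fin (n + 1)) => x i) ⁻¹'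
        ((fun (x : ℕ → A) (i : Fin (n + 1)) => x i) '' V n) := by
      intro n
      refine (Set.subset_preimage_image _ _).antisymm ?_
      rintro x ⟨y, hy, hxy⟩ z hz
      refine hy (mem_cyl_zero.2 fun i hi => ?_)
      rw [mem_cyl_zero.1 hz i hi]
      exact (congrFun hxy ⟨i, hi⟩).symm
    rw [hV, hmono.measure_iUnion, hmono.measure_iUnion]
    refine iSup_mono fun n => ?_
    rw [hsat n]
    exact measure_preimage_le_of_cyl (fun a => h a n) _
  rw [Measure.le_iff]
  intro E _
  rw [E.measure_eq_iInf_isOpen ν]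
  exact le_iInf₂ fun U hEU => le_iInf fun hU => (measure_mono hEU).trans (hopen U hU)

end Cylinders

/-! ### Ergodicity and uniqueness of Gibbs measures -/

section Gibbs

variable {A : Type*} {ψ : (ℕ → A) → ℝ} {t : ℕ → ℝ}

theorem HasTail.abs_birkhoffSum_sub_le (hψ : HasTail ψ t) {n : ℕ} {a b : ℕ → A}
    (h : ∀ i < n, a i = b i) :
    |birkhoffSum shift ψ n a - birkhoffSum shift ψ n b| ≤ t 0 - t n := by
  induction n generalizing a b with
  | zero => simp
  | succ n ih =>
    have h1 := ih (a := shift a) (b := shift b) fun i hi => h (i + 1) (by omega)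
    have h2 := hψ.abs_sub_le n a b h
    rw [birkhoffSum_succ', birkhoffSum_succ']
    rw [abs_le] at *
    constructor <;> linarith [h1.1, h1.2, h2.1, h2.2]

theorem transferIter_singleton (a : ℕ → A) (n : ℕ) (f : (ℕ → A) → ℝ) :
    transferIter ψ (fun i => {a i}) n f (shift^[n] a) =
      Real.exp (birkhoffSum shift ψ n a) * f a := by
  induction n generalizing a f with
  | zero => simp [transferIter_zero]
  | succ n ih =>
    have h1 := ih (shift a) (transfer ψ {a 0} f)
    have h2 : prepend (a 0) (shift a) = a := by
      ext (_ | i) <;> rfl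
    rw [transferIter_succ', Function.iterate_succ_apply, birkhoffSum_succ']
    refine h1.trans ?_
    rw [transfer_apply, Finset.sum_singleton, h2, Real.exp_add]
    ring

variable [TopologicalSpace A] [MeasurableSpace A]

theorem IsGibbsWith.exists_bounds {μ : Measure (ℕ → A)} {P : ℝ} (h : IsGibbsWith μ ψ P) :
    ∃ C : ℝ, 1 ≤ C ∧ ∀ (n : ℕ) (a : ℕ → A),
      Real.exp (birkhoffSum shift ψ (n + 1) a - (n + 1) * P) ≤ C * μ.real (cyl a 0 n) ∧
      μ.real (cyl a 0 n) ≤ C * Real.exp (birkhoffSum shift ψ (n + 1) a - (n + 1) * P) := by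
  obtain ⟨C, hC, hb⟩ := h.gibbs_inequality
  refine ⟨C, hC, fun n a => ?_⟩
  have h1 := hb n a
  rw [le_div_iff₀ (Real.exp_pos _), inv_mul_le_iff₀ (by linarith),
    div_le_iff₀ (Real.exp_pos _)] at h1
  exact h1

/-- Two Gibbs measures of the same potential are comparable on cylinders, up to the exponential
factor coming from the difference of the constants `P` and `Q`. -/
theorem IsGibbsWith.exists_measure_cyl_le {μ ρ : Measure (ℕ → A)} {P Q : ℝ}
    (hμ : IsGibbsWith μ ψ P) (hρ : IsGibbsWith ρ ψ Q) :
    ∃ K : ℝ, 0 < K ∧ ∀ n a, ρ (cyl a 0 n) ≤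
      (ENNReal.ofReal (K * Real.exp ((n + 1) * (P - Q))) • μ) (cyl a 0 n) := by
  have := hμ.isProbabilityMeasure
  have := hρ.isProbabilityMeasure
  obtain ⟨C, hC, hb⟩ := hμ.exists_bounds
  obtain ⟨C', hC', hb'⟩ := hρ.exists_bounds
  refine ⟨C' * C, by nlinarith, fun n a => ?_⟩
  rw [Measure.smul_apply, smul_eq_mul, ← ofReal_measureReal, ← ofReal_measureReal,
    ← ENNReal.ofReal_mul (by positivity)]
  refine ENNReal.ofReal_le_ofReal ?_
  calc ρ.real (cyl a 0 n) ≤ C' * Real.exp (birkhoffSum shift ψ (n + 1) a - (n + 1) * Q) :=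
        (hb' n a).2
    _ = C' * Real.exp ((n + 1) * (P - Q)) *
        Real.exp (birkhoffSum shift ψ (n + 1) a - (n + 1) * P) := by
      rw [mul_assoc, ← Real.exp_add]
      congr 2
      ring
    _ ≤ C' * Real.exp ((n + 1) * (P - Q)) * (C * μ.real (cyl a 0 n)) := by
      gcongr
      exact (hb n a).1
    _ = _ := by ring

variable [DiscreteMeasurableSpace A] [Fintype A]

/-- The constant in the Gibbs inequality is determined by the potential: otherwise one of the
measures would have total mass less than `1`. -/
theorem IsGibbsWith.const_le {μ ρ : Measure (ℕ → A)} {P Q : ℝ}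
    (hμ : IsGibbsWith μ ψ P) (hρ : IsGibbsWith ρ ψ Q) : Q ≤ P := by
  have := hμ.isProbabilityMeasure
  have := hρ.isProbabilityMeasure
  obtain ⟨K, hK, hb⟩ := hμ.exists_measure_cyl_le hρ
  have h1 : ∀ n : ℕ, 1 ≤ K * Real.exp ((n + 1) * (P - Q)) := fun n => by
    have := measure_univ_le_of_cyl (hb n)
    simpa using this
  by_contra! hPQ
  have h2 : Tendsto (fun n : ℕ => K * Real.exp ((n + 1) * (P - Q))) atTop (𝓝 (K * 0)) := by
    refine (Real.tendsto_exp_atBot.comp ?_).const_mul K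
    exact (tendsto_natCast_atTop_atTop.atTop_add tendsto_const_nhds).atTop_mul_const_of_neg
      (by linarith)
  rw [mul_zero] at h2
  have := ge_of_tendsto' h2 h1
  linarith

variable [DiscreteTopology A]

/-- Words may be concatenated freely under a Gibbs measure, at the price of a constant. -/
theorem IsGibbsWith.exists_mul_le_measure_inter {μ : Measure (ℕ → A)} {P : ℝ}
    (h : IsGibbsWith μ ψ P) (hψ : HasTail ψ t) :
    ∃ κ : ℝ, 0 < κ ∧ ∀ (a : ℕ → A) (n : ℕ) (E : Set (ℕ → A)), MeasurableSet E →
      ENNReal.ofReal κ * μ (cyl a 0 n) * μ E ≤ μ (cyl a 0 n ∩ shift^[n + 1] ⁻¹' E) := by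
  have := h.isProbabilityMeasure
  obtain ⟨C, hC, hb⟩ := h.exists_bounds
  have hC0 : 0 < C := by linarith
  refine ⟨(C * C * C * Real.exp (t 0))⁻¹, by positivity, fun a n E hE => ?_⟩
  have hmeas : Measurable (shift^[n + 1] : (ℕ → A) → ℕ → A) := measurable_shift.iterate _
  have key : (ENNReal.ofReal (C * C * C * Real.exp (t 0))⁻¹ * μ (cyl a 0 n)) • μ ≤
      (μ.restrict (cyl a 0 n)).map shift^[n + 1] := by
    have : IsFiniteMeasure ((μ.restrict (cyl a 0 n)).map shift^[n + 1]) :=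
      Measure.isFiniteMeasure_map _ _
    refine measure_le_of_cyl fun b m => ?_
    rw [Measure.map_apply hmeas (measurableSet_cyl b m),
      Measure.restrict_apply (hmeas (measurableSet_cyl b m)), Measure.smul_apply, smul_eq_mul]
    -- the word `a_0 ⋯ a_n` followed by `b`
    set c : ℕ → A := fun i => if i < n + 1 then a i else b (i - (n + 1)) with hc
    have hcT : shift^[n + 1] c = b := by
      rw [shift_iterate]
      ext i
      simp only [hc, if_neg (show ¬i + (n + 1) < n + 1 by omega), Nat.add_sub_cancel]
    have hset : shift^[n + 1] ⁻¹' cyl b 0 m ∩ cyl a 0 n = cyl c 0 (n + 1 + m) := by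
      ext x
      simp only [Set.mem_inter_iff, Set.mem_preimage, mem_cyl_zero, shift_iterate, hc]
      constructor
      · rintro ⟨h1, h2⟩ i hi
        split_ifs with hin
        · exact h2 i hin
        · rw [← h1 (i - (n + 1)) (by omega)]
          congr 1
          omega
      · intro hx
        refine ⟨fun i hi => ?_, fun i hi => ?_⟩
        · rw [hx (i + (n + 1)) (by omega), if_neg (by omega), Nat.add_sub_cancel]
        · rw [hx i (by omega), if_pos hi]
    rw [hset, ← ofReal_measureReal, ← ofReal_measureReal, ← ofReal_measureReal,
      ← ENNReal.ofReal_mul (by positivity), ← ENNReal.ofReal_mul (by positivity)]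
    refine ENNReal.ofReal_le_ofReal ?_
    have e1 := (hb n a).2
    have e2 := (hb m b).2
    have e3 := (hb (n + 1 + m) c).1
    have e4 := (abs_le.1 (hψ.abs_birkhoffSum_sub_le (n := n + 1) (a := a) (b := c)
      fun i hi => by simp only [hc, if_pos hi])).2
    have e5 : t 0 - t (n + 1) ≤ t 0 := by linarith [hψ.nonneg (n + 1)]
    have e6 : birkhoffSum shift ψ (n + 1 + m + 1) c =
        birkhoffSum shift ψ (n + 1) c + birkhoffSum shift ψ (m + 1) b := by
      rw [add_assoc (n + 1) m 1, birkhoffSum_add, hcT]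
    rw [mul_assoc, inv_mul_le_iff₀ (by positivity)]
    calc μ.real (cyl a 0 n) * μ.real (cyl b 0 m)
        ≤ (C * Real.exp (birkhoffSum shift ψ (n + 1) a - (n + 1) * P)) *
          (C * Real.exp (birkhoffSum shift ψ (m + 1) b - (m + 1) * P)) := by gcongr
      _ = C * C * Real.exp (birkhoffSum shift ψ (n + 1) a - (n + 1) * P +
          (birkhoffSum shift ψ (m + 1) b - (m + 1) * P)) := by rw [Real.exp_add]; ring
      _ ≤ C * C * Real.exp (t 0 + (birkhoffSum shift ψ (n + 1 + m + 1) c -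
          (((n + 1 + m : ℕ) : ℝ) + 1) * P)) := by
        refine mul_le_mul_of_nonneg_left (Real.exp_le_exp.2 ?_) (by positivity)
        rw [e6]
        push_cast
        linarith
      _ = C * C * Real.exp (t 0) * Real.exp (birkhoffSum shift ψ (n + 1 + m + 1) c -
          (((n + 1 + m : ℕ) : ℝ) + 1) * P) := by rw [Real.exp_add]; ring
      _ ≤ C * C * Real.exp (t 0) * (C * μ.real (cyl c 0 (n + 1 + m))) := by gcongr
      _ = _ := by ring
  have := (Measure.le_iff.1 key) E hE
  rw [Measure.map_apply hmeas hE, Measure.restrict_apply (hmeas hE), Measure.smul_apply,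
    smul_eq_mul, Set.inter_comm] at this
  exact this

theorem IsGibbsWith.ergodic {μ : Measure (ℕ → A)} {P : ℝ}
    (h : IsGibbsWith μ ψ P) (hψ : HasTail ψ t) : Ergodic shift μ := by
  have := h.isProbabilityMeasure
  obtain ⟨κ, hκ, hmix⟩ := h.exists_mul_le_measure_inter hψ
  refine ⟨h.invariant, ⟨fun s hs hfs => ?_⟩⟩
  by_contra H
  obtain ⟨h1, h2⟩ : μ s ≠ 0 ∧ μ sᶜ ≠ 0 := by
    simpa [eventuallyConst_set, ae_iff, and_comm] using! H
  have hit : ∀ n, shift^[n] ⁻¹' s = s := fun n => by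
    induction n with
    | zero => rfl
    | succ n ih => rw [Function.iterate_succ, Set.preimage_comp, ih, hfs]
  have key : (ENNReal.ofReal κ * μ s) • μ ≤ μ.restrict s := by
    refine measure_le_of_cyl fun a n => ?_
    rw [Measure.smul_apply, smul_eq_mul, Measure.restrict_apply (measurableSet_cyl a n)]
    have := hmix a n s hs
    rw [hit] at this
    rwa [mul_right_comm]
  have := Measure.le_iff.1 key _ hs.compl
  rw [Measure.smul_apply, smul_eq_mul, Measure.restrict_apply hs.compl, Set.compl_inter_self,
    measure_empty, nonpos_iff_eq_zero, mul_eq_zero, mul_eq_zero] at this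
  rcases this with (h3 | h3) | h3
  · rw [ENNReal.ofReal_eq_zero] at h3
    linarith
  · exact h1 h3
  · exact h2 h3

theorem HasTail.gibbs_unique (hψ : HasTail ψ t) {μ ρ : Measure (ℕ → A)} (hμ : IsGibbs μ ψ)
    (hρ : IsGibbs ρ ψ) : ρ = μ := by
  obtain ⟨P, hμ⟩ := hμ
  obtain ⟨Q, hρ⟩ := hρ
  have := hμ.isProbabilityMeasure
  have := hρ.isProbabilityMeasure
  obtain rfl : P = Q := le_antisymm (hρ.const_le hμ) (hμ.const_le hρ)
  obtain ⟨K, -, hb⟩ := hμ.exists_measure_cyl_le hρ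
  simp only [sub_self, mul_zero, Real.exp_zero, mul_one] at hb
  have : IsFiniteMeasure (ENNReal.ofReal K • μ) := Measure.smul_finite μ ENNReal.ofReal_ne_top
  have hle : ρ ≤ ENNReal.ofReal K • μ := measure_le_of_cyl fun a n => hb n a
  exact (hμ.ergodic hψ).eq_of_absolutelyContinuous hρ.invariant
    (Measure.absolutelyContinuous_of_le_smul hle)

/-! ### Existence of the Gibbs measure -/

theorem IsCompatible.isGibbsWith [Nonempty A] (hψ : HasTail ψ t) (ht0 : Tendsto t atTop (𝓝 0))
    {l : ℝ} {h : (ℕ → A) → ℝ} (H : IsEigen ψ t l h) {μ : Measure (ℕ → A)}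
    [IsProbabilityMeasure μ] (hμ : IsCompatible ψ l h μ) : IsGibbsWith μ ψ (Real.log l) where
  continuous := continuous_of_abs_sub_le (w := fun m => t m - t (m + 1))
    (by simpa using ht0.sub ((tendsto_add_atTop_iff_nat 1).2 ht0)) hψ.abs_sub_le
  isProbabilityMeasure := inferInstance
  invariant := by
    have hl := H.eigenvalue_pos
    have hcyl : ∀ a n, μ.real (shift ⁻¹' cyl a 0 n) = μ.real (cyl a 0 n) := by
      intro a n
      set S : ℕ → Finset A := fun i => {a i} with hS
      set S' : ℕ → Finset A := fun i => if i = 0 then Finset.univ else {a (i - 1)} with hS'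
      have hset : shift ⁻¹' cyl a 0 n = cylSet S' (n + 1 + 1) := by
        ext x
        rw [Set.mem_preimage, mem_cyl_zero]
        constructor
        · rintro hx (_ | i) hi
          · simp [hS']
          · have : x (i + 1) = a i := hx i (by omega)
            simp [hS', this]
        · intro hx i hi
          have : x (i + 1) = a i := by simpa [hS'] using hx (i + 1) (by omega)
          exact this
      have hiter : transferIter ψ S' (n + 1 + 1) h = l • transferIter ψ S (n + 1) h := by
        rw [transferIter_succ', ← map_smul, ← H.eigen]
        exact transferIter_congr (fun i _ => by simp [hS, hS']) _
      have h1 := hμ.le_mul H.regular.nonneg (S := S) (S' := S') (n := n + 1) (n' := n + 1 + 1)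
        (c := l) fun z => by rw [hiter]; rfl
      have h2 := hμ.le_mul H.regular.nonneg (S := S') (S' := S) (n := n + 1 + 1) (n' := n + 1)
        (c := l⁻¹) fun z => by
        rw [hiter, Pi.smul_apply, smul_eq_mul, inv_mul_cancel_left₀ hl.ne']
      rw [hset, cyl_zero_eq_cylSet, ← hS]
      have hp : 0 < l ^ (n + 1) := pow_pos hl _
      rw [← mul_assoc, ← pow_succ'] at h1
      rw [pow_succ' l (n + 1), mul_assoc, inv_mul_cancel_left₀ hl.ne'] at h2
      exact le_antisymm (le_of_mul_le_mul_left h1 (pow_pos hl _)) (le_of_mul_le_mul_left h2 hp)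
    have hcyl' : ∀ a n, μ.map shift (cyl a 0 n) = μ (cyl a 0 n) := by
      intro a n
      rw [Measure.map_apply measurable_shift (measurableSet_cyl a n), ← ofReal_measureReal, hcyl,
        ofReal_measureReal]
    have : IsFiniteMeasure (μ.map shift) := Measure.isFiniteMeasure_map _ _
    exact ⟨measurable_shift, le_antisymm (measure_le_of_cyl fun a n => (hcyl' a n).le)
      (measure_le_of_cyl fun a n => (hcyl' a n).ge)⟩
  gibbs_inequality := by
    have hl := H.eigenvalue_pos
    refine ⟨Real.exp (2 * t 0), Real.one_le_exp (by linarith [hψ.nonneg 0]), fun n a => ?_⟩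
    set S : ℕ → Finset A := fun i => {a i} with hS
    set B := birkhoffSum shift ψ (n + 1) a with hB
    have hreg : IsRegular t (transferIter ψ S (n + 1) h) := H.regular.transferIter hψ S _
    have hval : transferIter ψ S (n + 1) h (shift^[n + 1] a) = Real.exp B * h a :=
      transferIter_singleton a (n + 1) h
    have hz : cylSet S 0 = Set.univ := by ext; simp [cylSet]
    have h1 := hμ.le_mul H.regular.nonneg (S := S) (S' := S) (n := 0) (n' := n + 1)
      (c := Real.exp (2 * t 0) * Real.exp B) fun z => by
      calc transferIter ψ S (n + 1) h z
          ≤ Real.exp (t 0) * (Real.exp B * h a) := hval ▸ hreg.le_exp_zero_mul z _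
        _ ≤ Real.exp (t 0) * (Real.exp B * (Real.exp (t 0) * h z)) := by
          have := H.regular.le_exp_zero_mul a z
          gcongr
        _ = Real.exp (2 * t 0) * Real.exp B * h z := by rw [two_mul, Real.exp_add]; ring
    have h2 := hμ.le_mul H.regular.nonneg (S := S) (S' := S) (n := n + 1) (n' := 0)
      (c := Real.exp (2 * t 0) * Real.exp (-B)) fun z => by
      calc h z ≤ Real.exp (t 0) * h a := H.regular.le_exp_zero_mul z a
        _ = Real.exp (t 0) * (Real.exp (-B) * (Real.exp B * h a)) := by
          rw [← mul_assoc (Real.exp (-B)), ← Real.exp_add]; simp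
        _ ≤ Real.exp (t 0) * (Real.exp (-B) *
            (Real.exp (t 0) * transferIter ψ S (n + 1) h z)) := by
          rw [← hval]
          have := hreg.le_exp_zero_mul (shift^[n + 1] a) z
          exact mul_le_mul_of_nonneg_left (mul_le_mul_of_nonneg_left this (Real.exp_pos _).le)
            (Real.exp_pos _).le
        _ = Real.exp (2 * t 0) * Real.exp (-B) * transferIter ψ S (n + 1) h z := by
          rw [two_mul, Real.exp_add]; ring
    rw [hz, probReal_univ] at h1 h2
    simp only [pow_zero, mul_one] at h1 h2
    have hexp : Real.exp (B - (n + 1) * Real.log l) = Real.exp B / l ^ (n + 1) := by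
      rw [Real.exp_sub]
      congr 1
      rw [← Real.exp_log (pow_pos hl (n + 1)), Real.log_pow]
      push_cast
      rfl
    rw [hexp, cyl_zero_eq_cylSet, ← hS, div_div_eq_mul_div, mul_comm (μ.real _)]
    constructor
    · rw [le_div_iff₀ (Real.exp_pos _), inv_mul_le_iff₀ (Real.exp_pos _)]
      have h3 := mul_le_mul_of_nonneg_left h2 (Real.exp_pos B).le
      have h4 : Real.exp B * Real.exp (-B) = 1 := by rw [← Real.exp_add]; simp
      calc Real.exp B = Real.exp B * 1 := (mul_one _).symm
        _ ≤ _ := h3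
        _ = Real.exp B * Real.exp (-B) *
            (Real.exp (2 * t 0) * (l ^ (n + 1) * μ.real (cylSet S (n + 1)))) := by ring
        _ = _ := by rw [h4, one_mul]
    · rw [div_le_iff₀ (Real.exp_pos _)]
      exact h1

end Gibbs

/-! ### The projected potential -/

theorem abs_log_sub_log_le {c x y : ℝ} (hc : 0 < c) (hx : c ≤ x) (hy : c ≤ y) :
    |Real.log x - Real.log y| ≤ |x - y| / c := by
  have key : ∀ {u v : ℝ}, c ≤ u → c ≤ v → Real.log u - Real.log v ≤ |u - v| / c := by
    intro u v hu hv
    have hu0 : 0 < u := hc.trans_le hu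
    have hv0 : 0 < v := hc.trans_le hv
    rw [← Real.log_div hu0.ne' hv0.ne']
    calc Real.log (u / v) ≤ u / v - 1 := Real.log_le_sub_one_of_pos (div_pos hu0 hv0)
      _ = (u - v) / v := by field_simp
      _ ≤ |u - v| / v := by gcongr; exact le_abs_self _
      _ ≤ |u - v| / c := by gcongr
  rw [abs_le]
  have h1 := key hx hy
  have h2 := key hy hx
  rw [abs_sub_comm] at h2
  constructor <;> linarith

open Classical in
/-- The symbols of `A` that may stand above each symbol of the sequence `b`. -/
noncomputable def fibers {A B : Type*} [Fintype A] (π : A → B) (b : ℕ → B) : ℕ → Finset A :=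
  fun i => Finset.univ.filter fun x => π x = b i

section Fibers

variable {A B : Type*} [Fintype A] {π : A → B}

theorem mem_fibers {b : ℕ → B} {i : ℕ} {x : A} : x ∈ fibers π b i ↔ π x = b i := by
  simp [fibers]

theorem fibers_nonempty (hπ : Function.Surjective π) (b : ℕ → B) (i : ℕ) :
    (fibers π b i).Nonempty := by
  obtain ⟨x, hx⟩ := hπ (b i)
  exact ⟨x, mem_fibers.2 hx⟩

theorem fibers_congr {b b' : ℕ → B} {i : ℕ} (h : b i = b' i) : fibers π b i = fibers π b' i := by
  ext x
  rw [mem_fibers, mem_fibers, h]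

theorem preimage_cyl_zero (b : ℕ → B) (n : ℕ) :
    amalgam π ⁻¹' cyl b 0 n = cylSet (fibers π b) (n + 1) := by
  ext x
  simp only [Set.mem_preimage, mem_cyl_zero, cylSet, Set.mem_ofPred_eq, mem_fibers]
  rfl

theorem preimage_cyl_one (b : ℕ → B) (n : ℕ) :
    amalgam π ⁻¹' cyl b 1 n = cylSet (fibers π (shift b)) n := by
  ext x
  simp only [Set.mem_preimage, cyl, cylSet, Set.mem_ofPred_eq, mem_fibers]
  refine forall_congr' fun i => ?_
  rw [show shift b i = b (1 + i) from congrArg b (add_comm i 1), add_comm 1 i,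
    Nat.succ_le_iff]
  rfl

theorem cylSet_fibers_congr {b b' : ℕ → B} {n : ℕ} (h : ∀ i < n, b i = b' i) :
    cylSet (fibers π b) n = cylSet (fibers π b') n := by
  ext x
  exact forall₂_congr fun i hi => by rw [fibers_congr (h i hi)]

variable [MeasurableSpace A] [MeasurableSpace B] [DiscreteMeasurableSpace A]

theorem measurable_amalgam : Measurable (amalgam π) :=
  measurable_pi_lambda _ fun n => (measurable_of_countable π).comp (measurable_pi_apply n)

variable [DiscreteMeasurableSpace B]

theorem measurableSet_cyl_one (b : ℕ → B) (n : ℕ) : MeasurableSet (cyl b 1 n) := by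
  have : cyl b 1 n = cylSet (fun i => {b (1 + i)}) n := by
    ext x
    simp only [cyl, cylSet, Set.mem_ofPred_eq, Finset.mem_singleton]
    refine forall_congr' fun i => ?_
    rw [add_comm 1 i, Nat.succ_le_iff]
  rw [this]
  exact measurableSet_cylSet _ _

theorem map_real_cyl_zero (μ : Measure (ℕ → A)) (b : ℕ → B) (n : ℕ) :
    (μ.map (amalgam π)).real (cyl b 0 n) = μ.real (cylSet (fibers π b) (n + 1)) := by
  rw [measureReal_def, Measure.map_apply measurable_amalgam (measurableSet_cyl b n),
    preimage_cyl_zero, measureReal_def]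

theorem map_real_cyl_one (μ : Measure (ℕ → A)) (b : ℕ → B) (n : ℕ) :
    (μ.map (amalgam π)).real (cyl b 1 n) = μ.real (cylSet (fibers π (shift b)) n) := by
  rw [measureReal_def, Measure.map_apply measurable_amalgam (measurableSet_cyl_one b n),
    preimage_cyl_one, measureReal_def]

end Fibers

section Projection

variable {A B : Type*} {ψ : (ℕ → A) → ℝ} {t : ℕ → ℝ} {π : A → B}

theorem IsCompatible.mul_le [Fintype A] [MeasurableSpace A] [Nonempty A] {l : ℝ}
    {h : (ℕ → A) → ℝ} {μ : Measure (ℕ → A)} (hμ : IsCompatible ψ l h μ) (hl : 0 < l)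
    (hh : ∀ z, 0 ≤ h z) {S S' : ℕ → Finset A} {n n' : ℕ} {c : ℝ}
    (hc : ∀ z, c * transferIter ψ S n h z ≤ transferIter ψ S' n' h z) :
    c * (l ^ n * μ.real (cylSet S n)) ≤ l ^ n' * μ.real (cylSet S' n') := by
  rcases le_or_gt c 0 with hc0 | hc0
  · exact (mul_nonpos_of_nonpos_of_nonneg hc0 (by positivity)).trans (by positivity)
  · have := hμ.le_mul hh (S := S') (S' := S) (n := n') (n' := n) (c := c⁻¹) fun z => by
      rw [le_inv_mul_iff₀ hc0]
      exact hc z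
    rwa [le_inv_mul_iff₀ hc0] at this

theorem HasTail.exists_abs_le [Fintype A] (hψ : HasTail ψ t) : ∃ M, ∀ z, |ψ z| ≤ M := by
  refine ⟨∑ x : A, |ψ fun _ => x| + t 0, fun z => ?_⟩
  have h1 : |ψ fun _ => z 0| ≤ ∑ x : A, |ψ fun _ => x| :=
    Finset.single_le_sum (f := fun x : A => |ψ fun _ => x|) (fun _ _ => abs_nonneg _)
      (Finset.mem_univ (z 0))
  have h2 := hψ.abs_sub_le 0 z (fun _ => z 0) fun i hi => by
    rw [Nat.lt_one_iff.1 hi]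
  have h3 := abs_sub_abs_le_abs_sub (ψ z) (ψ fun _ => z 0)
  have h4 := hψ.nonneg 1
  linarith

/-- The ratios `μ∘π⁻¹[b_0^n] / μ∘π⁻¹[b_1^n]` converge to a limit bounded away from zero, at the
memory rate. -/
theorem IsCompatible.exists_ratio_limit [Fintype A] [MeasurableSpace A] [Nonempty A]
    (hψ : HasTail ψ t) (ht0 : Tendsto t atTop (𝓝 0)) {l : ℝ} {h : (ℕ → A) → ℝ} (H : IsEigen ψ t l h)
    {μ : Measure (ℕ → A)} [IsProbabilityMeasure μ] (hμ : IsCompatible ψ l h μ)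
    (hπ : Function.Surjective π) :
    ∃ (Q : (ℕ → B) → ℝ) (c : ℝ), 0 < c ∧ ∀ b, c ≤ Q b ∧
      ∀ n, 0 < μ.real (cylSet (fibers π b) n) ∧
        c ≤ μ.real (cylSet (fibers π b) (n + 1)) / μ.real (cylSet (fibers π (shift b)) n) ∧
        ∀ r, |μ.real (cylSet (fibers π b) (n + 1)) / μ.real (cylSet (fibers π (shift b)) n) -
          Q b| ≤ memoryRate t n r := by
  obtain ⟨M, hM⟩ := hψ.exists_abs_le
  have hl := H.eigenvalue_pos
  set c := l⁻¹ * (Real.exp (-M) * Real.exp (-t 0)) with hc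
  have hc0 : 0 < c := by positivity
  set f : (ℕ → B) → (ℕ → A) → ℝ := fun b => l⁻¹ • transfer ψ (fibers π b 0) h with hf
  have hfreg : ∀ b, IsRegular t (f b) := fun b =>
    (H.regular.transfer hψ _).smul (inv_nonneg.2 hl.le)
  have hf1 : ∀ b z, f b z ≤ 1 * h z := by
    intro b z
    have := transfer_le_univ (ψ := ψ) (fibers π b 0) H.regular.nonneg z
    rw [H.eigen] at this
    simp only [Pi.smul_apply, smul_eq_mul] at this
    rw [one_mul, hf]
    simp only [Pi.smul_apply, smul_eq_mul]
    rwa [inv_mul_le_iff₀ hl]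
  have hfc : ∀ b, c • h ≤ f b := by
    intro b z
    obtain ⟨x, hx⟩ := fibers_nonempty hπ b 0
    simp only [hf, hc, Pi.smul_apply, smul_eq_mul, mul_assoc]
    refine mul_le_mul_of_nonneg_left ?_ (inv_nonneg.2 hl.le)
    have h1 : Real.exp (ψ (prepend x z)) * h (prepend x z) ≤ transfer ψ (fibers π b 0) h z :=
      Finset.single_le_sum (f := fun x => Real.exp (ψ (prepend x z)) * h (prepend x z))
        (fun y _ => mul_nonneg (Real.exp_pos _).le (H.pos _).le) hx
    refine le_trans ?_ h1
    have h2 : -M ≤ ψ (prepend x z) := (abs_le.1 (hM _)).1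
    have h3 : Real.exp (-t 0) * h z ≤ h (prepend x z) := by
      rw [Real.exp_neg, inv_mul_le_iff₀ (Real.exp_pos _)]
      exact H.regular.le_exp_zero_mul _ _
    have h4 := H.pos z
    gcongr
  have hiter : ∀ b n, transferIter ψ (fibers π b) (n + 1) h =
      l • transferIter ψ (fibers π (shift b)) n (f b) := by
    intro b n
    rw [transferIter_succ', hf, map_smul, smul_smul, mul_inv_cancel₀ hl.ne', one_smul]
    rfl
  have hstep : ∀ b n (κ : ℝ), (∀ z, κ * transferIter ψ (fibers π (shift b)) n h z ≤
      transferIter ψ (fibers π (shift b)) n (f b) z) →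
      κ * μ.real (cylSet (fibers π (shift b)) n) ≤ μ.real (cylSet (fibers π b) (n + 1)) := by
    intro b n κ hκ
    have := hμ.mul_le hl H.regular.nonneg (S := fibers π (shift b)) (S' := fibers π b) (n := n)
      (n' := n + 1) (c := l * κ) fun z => by
        rw [hiter, Pi.smul_apply, smul_eq_mul, mul_assoc]
        exact mul_le_mul_of_nonneg_left (hκ z) hl.le
    refine le_of_mul_le_mul_left ?_ (pow_pos hl (n + 1))
    rw [pow_succ] at this ⊢
    linarith
  have hlow : ∀ b n, c * μ.real (cylSet (fibers π (shift b)) n) ≤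
      μ.real (cylSet (fibers π b) (n + 1)) := fun b n => by
    refine hstep b n c fun z => ?_
    have := transferIter_mono (ψ := ψ) (fibers π (shift b)) n (hfc b) z
    rwa [map_smul] at this
  have hW : ∀ n b, 0 < μ.real (cylSet (fibers π b) n) := by
    intro n
    induction n with
    | zero =>
      intro b
      have : cylSet (fibers π b) 0 = Set.univ := by ext; simp [cylSet]
      rw [this, probReal_univ]
      exact one_pos
    | succ n ih => exact fun b => (mul_pos hc0 (ih (shift b))).trans_le (hlow b n)
  have hg : ∀ b n z, 0 < transferIter ψ (fibers π (shift b)) n h z := fun b n =>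
    transferIter_pos (fibers_nonempty hπ _) n H.pos
  have hex := fun b => hψ.exists_ratio_limit ht0 (fibers_nonempty hπ (shift b)) (hfreg b)
    H.regular H.pos one_pos (hf1 b)
  choose Q hQ hQb using hex
  have a : ℕ → A := fun _ => Classical.arbitrary A
  have hQc : ∀ b, c ≤ Q b := fun b => by
    refine ge_of_tendsto' (hQ b a) fun n => ?_
    rw [le_div_iff₀ (hg b n a)]
    have := transferIter_mono (ψ := ψ) (fibers π (shift b)) n (hfc b) a
    rwa [map_smul] at this
  refine ⟨Q, c, hc0, fun b => ⟨hQc b, fun n => ⟨hW n b, ?_, fun r => ?_⟩⟩⟩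
  · rw [le_div_iff₀ (hW n _)]
    exact hlow b n
  · have hb := fun z => abs_le.1 (hQb b n n r z le_rfl)
    rw [abs_le]
    constructor
    · rw [neg_le_sub_iff_le_add, ← sub_le_iff_le_add, le_div_iff₀ (hW n _)]
      refine hstep b n _ fun z => ?_
      rw [← le_div_iff₀ (hg b n z)]
      linarith [(hb z).1]
    · rw [sub_le_iff_le_add, div_le_iff₀ (hW n _)]
      have := hμ.le_mul H.regular.nonneg (S := fibers π (shift b)) (S' := fibers π b) (n := n)
        (n' := n + 1) (c := l * (memoryRate t n r + Q b)) fun z => by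
          rw [hiter, Pi.smul_apply, smul_eq_mul, mul_assoc]
          refine mul_le_mul_of_nonneg_left ?_ hl.le
          rw [← div_le_iff₀ (hg b n z)]
          linarith [(hb z).2]
      refine le_of_mul_le_mul_left ?_ (pow_pos hl (n + 1))
      rw [pow_succ] at this ⊢
      linarith

end Projection

section ProjectedGibbs

variable {A B : Type*} [Fintype A] [MeasurableSpace A] {π : A → B} {μ : Measure (ℕ → A)}

theorem abs_log_sub_birkhoffSum_le [IsProbabilityMeasure μ] {φ : (ℕ → B) → ℝ} {ε : ℕ → ℝ}
    (hpos : ∀ b n, 0 < μ.real (cylSet (fibers π b) n))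
    (hφ : ∀ b n, |Real.log (μ.real (cylSet (fibers π b) (n + 1)) /
      μ.real (cylSet (fibers π (shift b)) n)) - φ b| ≤ ε n) (n : ℕ) (b : ℕ → B) :
    |Real.log (μ.real (cylSet (fibers π b) n)) - birkhoffSum shift φ n b| ≤
      ∑ k ∈ Finset.range n, ε k := by
  induction n generalizing b with
  | zero =>
    have : cylSet (fibers π b) 0 = Set.univ := by ext; simp [cylSet]
    simp [this]
  | succ n ih =>
    have h1 := ih (shift b)
    have h2 := hφ b n
    rw [Real.log_div (hpos _ _).ne' (hpos _ _).ne'] at h2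
    rw [birkhoffSum_succ', Finset.sum_range_succ]
    rw [abs_le] at *
    constructor <;> linarith [h1.1, h1.2, h2.1, h2.2]

variable [DiscreteMeasurableSpace A] [MeasurableSpace B] [DiscreteMeasurableSpace B]
  [TopologicalSpace B]

/-- If the logarithms of the ratios `μ∘π⁻¹[b_0^n] / μ∘π⁻¹[b_1^n]` converge to `φ` at a summable
rate, then the product of these ratios along the orbit shows that `μ∘π⁻¹` is a Gibbs measure for
`φ`. -/
theorem isGibbsWith_map [IsProbabilityMeasure μ] (hinv : MeasurePreserving shift μ μ)
    {φ : (ℕ → B) → ℝ} {ε : ℕ → ℝ} (hφc : Continuous φ) (hε : Summable ε)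
    (hpos : ∀ b n, 0 < μ.real (cylSet (fibers π b) n))
    (hφ : ∀ b n, |Real.log (μ.real (cylSet (fibers π b) (n + 1)) /
      μ.real (cylSet (fibers π (shift b)) n)) - φ b| ≤ ε n) :
    IsGibbsWith (μ.map (amalgam π)) φ 0 where
  continuous := hφc
  isProbabilityMeasure := Measure.isProbabilityMeasure_map measurable_amalgam.aemeasurable
  invariant := by
    refine ⟨measurable_shift, ?_⟩
    have : shift ∘ amalgam π = amalgam π ∘ shift := rfl
    rw [Measure.map_map measurable_shift measurable_amalgam, this,
      ← Measure.map_map measurable_amalgam measurable_shift, hinv.map_eq]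
  gibbs_inequality := by
    rcases isEmpty_or_nonempty B with hB | hB
    · exact ⟨1, le_rfl, fun n a => (IsEmpty.false (a 0)).elim⟩
    have hε0 : ∀ n, 0 ≤ ε n := fun n =>
      (abs_nonneg _).trans (hφ (fun _ => Classical.arbitrary B) n)
    refine ⟨Real.exp (∑' n, ε n), Real.one_le_exp (tsum_nonneg hε0), fun n b => ?_⟩
    have h1 := abs_le.1 (abs_log_sub_birkhoffSum_le hpos hφ (n + 1) b)
    have h2 := hε.sum_le_tsum (Finset.range (n + 1)) fun i _ => hε0 i
    have h3 : μ.real (cylSet (fibers π b) (n + 1)) / Real.exp (birkhoffSum shift φ (n + 1) b) =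
        Real.exp (Real.log (μ.real (cylSet (fibers π b) (n + 1))) -
          birkhoffSum shift φ (n + 1) b) := by
      rw [Real.exp_sub, Real.exp_log (hpos _ _)]
    rw [map_real_cyl_zero, mul_zero, sub_zero, h3, ← Real.exp_neg, Real.exp_le_exp,
      Real.exp_le_exp]
    constructor <;> linarith [h1.1, h1.2]

end ProjectedGibbs

section GibbsConsequences

/-- Points of period `n + 1` are the periodic repetitions of the words of length `n + 1`. -/
theorem ptsOfPeriod_shift_eq_range {B : Type*} (n : ℕ) :
    Function.ptsOfPeriod (shift (A := B)) (n + 1) =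
      Set.range fun (w : Fin (n + 1) → B) (i : ℕ) => w ⟨i % (n + 1), Nat.mod_lt _ n.succ_pos⟩ := by
  ext a
  rw [Function.mem_ptsOfPeriod, Function.IsPeriodicPt, Function.IsFixedPt, shift_iterate]
  constructor
  · intro ha
    refine ⟨fun i => a i, funext fun i => ?_⟩
    have hp : Function.Periodic a (n + 1) := fun i => congrFun ha i
    exact hp.map_mod_nat i
  · rintro ⟨w, rfl⟩
    ext i
    simp only [Nat.add_mod_right]

variable {B : Type*} [TopologicalSpace B] [MeasurableSpace B]
  {ν : Measure (ℕ → B)} {φ : (ℕ → B) → ℝ} {P : ℝ}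

theorem IsGibbsWith.support_eq_univ [DiscreteTopology B] (h : IsGibbsWith ν φ P) :
    ν.support = Set.univ := by
  obtain ⟨C, hC, hb⟩ := h.exists_bounds
  have := h.isProbabilityMeasure
  have : ν.IsOpenPosMeasure := by
    refine ⟨fun U hU hne h0 => ?_⟩
    obtain ⟨x, hx⟩ := hne
    obtain ⟨n, hn⟩ := exists_cyl_subset hU hx
    have h1 : ν.real (cyl x 0 n) = 0 := by
      rw [measureReal_def, measure_mono_null hn h0, ENNReal.toReal_zero]
    have h2 := (hb n x).1
    rw [h1, mul_zero] at h2
    exact absurd h2 (not_le.2 (Real.exp_pos _))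
  exact Measure.support_eq_univ

/-- The sum over periodic points in the pressure is comparable with the total mass of a Gibbs
measure, hence bounded above and below. -/
theorem IsGibbsWith.pressure_eq_zero [DiscreteMeasurableSpace B] [Fintype B]
    (h : IsGibbsWith ν φ 0) : pressure φ = 0 := by
  obtain ⟨C, hC, hb⟩ := h.exists_bounds
  have := h.isProbabilityMeasure
  have hC0 : 0 < C := by linarith
  have hsum : ∀ n : ℕ,
      C⁻¹ ≤ ∑ᶠ a ∈ Function.ptsOfPeriod (shift (A := B)) (n + 1),
        Real.exp (birkhoffSum shift φ (n + 1) a) ∧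
      ∑ᶠ a ∈ Function.ptsOfPeriod (shift (A := B)) (n + 1),
        Real.exp (birkhoffSum shift φ (n + 1) a) ≤ C := by
    intro n
    set p : (Fin (n + 1) → B) → ℕ → B := fun w i => w ⟨i % (n + 1), Nat.mod_lt _ n.succ_pos⟩
      with hp
    have hpi : ∀ w (i : Fin (n + 1)), p w i = w i := fun w i =>
      congrArg w (Fin.ext (Nat.mod_eq_of_lt i.2))
    have hinj : Function.Injective p := fun w w' hw => funext fun i => by
      rw [← hpi w i, ← hpi w' i, hw]
    have hpre : ∀ w : Fin (n + 1) → B, cyl (p w) 0 n =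
        ((fun (x : ℕ → B) (i : Fin (n + 1)) => x i) ⁻¹' {w}) := by
      intro w
      ext x
      rw [mem_cyl_zero, Set.mem_preimage, Set.mem_singleton_iff, funext_iff]
      constructor
      · intro hx i
        rw [hx i i.2, hpi]
      · intro hx i hi
        exact (hx ⟨i, hi⟩).trans (hpi w ⟨i, hi⟩).symm
    have hone : ∑ w, ν.real (cyl (p w) 0 n) = 1 := by
      have h1 : ∑ w, ν (cyl (p w) 0 n) = 1 := by
        simp only [hpre]
        rw [sum_measure_preimage_singleton]
        · simp
        · intro w _
          rw [← hpre]
          exact measurableSet_cyl _ _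
      simp only [measureReal_def]
      rw [← ENNReal.toReal_sum fun w _ => measure_ne_top _ _, h1, ENNReal.toReal_one]
    rw [ptsOfPeriod_shift_eq_range, finsum_mem_range hinj, finsum_eq_sum_of_fintype]
    have hb' := fun w => hb n (p w)
    simp only [mul_zero, sub_zero] at hb'
    constructor
    · rw [inv_le_iff_one_le_mul₀ hC0, ← hone, Finset.sum_mul]
      refine Finset.sum_le_sum fun w _ => ?_
      rw [mul_comm]
      exact (hb' w).2
    · calc _ ≤ ∑ w, C * ν.real (cyl (p w) 0 n) := Finset.sum_le_sum fun w _ => (hb' w).1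
        _ = C := by rw [← Finset.mul_sum, hone, mul_one]
  have hlim : Tendsto (fun n : ℕ => 1 / (n : ℝ) * Real.log
      (∑ᶠ a ∈ Function.ptsOfPeriod (shift (A := B)) n, Real.exp (birkhoffSum shift φ n a)))
      atTop (𝓝 0) := by
    have hz : Tendsto (fun n : ℕ => 1 / (n : ℝ) * Real.log C) atTop (𝓝 0) := by
      simpa using tendsto_one_div_atTop_nhds_zero_nat.mul_const (Real.log C)
    refine squeeze_zero_norm' ?_ hz
    filter_upwards [eventually_ge_atTop 1] with n hn
    obtain ⟨m, rfl⟩ := Nat.exists_eq_add_of_le' hn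
    have h1 := hsum m
    rw [Real.norm_eq_abs, abs_mul, abs_of_nonneg (by positivity)]
    refine mul_le_mul_of_nonneg_left ?_ (by positivity)
    rw [abs_le, ← Real.log_inv]
    exact ⟨Real.log_le_log (by positivity) h1.1,
      Real.log_le_log ((inv_pos.2 hC0).trans_le h1.1) h1.2⟩
  exact ((continuous_coe_real_ereal.tendsto 0).comp hlim).limsup_eq

end GibbsConsequences

/-! ### Variations, tails and approximants -/

section Variation

variable {A : Type*} {ψ : (ℕ → A) → ℝ}

theorem abs_sub_le_var {n : ℕ} (h : var n ψ ≠ ∞) {x y : ℕ → A} (hxy : ∀ i ≤ n, x i = y i) :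
    |ψ x - ψ y| ≤ (var n ψ).toReal := by
  rw [← ENNReal.ofReal_le_iff_le_toReal h]
  exact le_iSup_of_le x (le_iSup_of_le y (le_iSup_of_le hxy le_rfl))

theorem var_le_ofReal {n : ℕ} {c : ℝ} (h : ∀ x y, (∀ i ≤ n, x i = y i) → |ψ x - ψ y| ≤ c) :
    var n ψ ≤ ENNReal.ofReal c :=
  iSup_le fun x => iSup_le fun y => iSup_le fun hxy => ENNReal.ofReal_le_ofReal (h x y hxy)

theorem var_ne_top_of_one_le (hψ : ∑' s : ℕ, (s : ℝ≥0∞) ^ 2 * var s ψ < ∞) {s : ℕ} (hs : 1 ≤ s) :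
    var s ψ ≠ ∞ := by
  intro htop
  have h1 : (s : ℝ≥0∞) ^ 2 * var s ψ ≤ ∑' s : ℕ, (s : ℝ≥0∞) ^ 2 * var s ψ := ENNReal.le_tsum s
  rw [htop, ENNReal.mul_top (pow_ne_zero 2 (Nat.cast_ne_zero.2 (by omega)))] at h1
  exact (h1.trans_lt hψ).ne rfl

/-- The weight `s ^ 2` vanishes at `s = 0`; the variation of order `0` is finite because that of
order `1` is and there are finitely many words of length `2`. -/
theorem var_ne_top [Fintype A] (hψ : ∑' s : ℕ, (s : ℝ≥0∞) ^ 2 * var s ψ < ∞) (s : ℕ) :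
    var s ψ ≠ ∞ := by
  rcases Nat.eq_zero_or_pos s with rfl | hs
  · have h1 := var_ne_top_of_one_le hψ le_rfl
    let p : A × A → ℝ := fun q => ψ fun i => if i = 0 then q.1 else q.2
    have hb : ∀ x, |ψ x| ≤ ∑ q, |p q| + (var 1 ψ).toReal := by
      intro x
      have h2 : |ψ x - p (x 0, x 1)| ≤ (var 1 ψ).toReal := by
        refine abs_sub_le_var h1 fun i hi => ?_
        interval_cases i <;> simp
      have h3 : |p (x 0, x 1)| ≤ ∑ q, |p q| :=
        Finset.single_le_sum (f := fun q => |p q|) (fun _ _ => abs_nonneg _)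
          (Finset.mem_univ (x 0, x 1))
      have h4 := abs_sub_abs_le_abs_sub (ψ x) (p (x 0, x 1))
      linarith
    refine ne_top_of_le_ne_top ENNReal.ofReal_ne_top (var_le_ofReal (c := 2 * (∑ q, |p q| +
      (var 1 ψ).toReal)) fun x y _ => ?_)
    have := abs_sub (ψ x) (ψ y)
    linarith [hb x, hb y]
  · exact var_ne_top_of_one_le hψ hs

theorem summable_sq_mul_var (hψ : ∑' s : ℕ, (s : ℝ≥0∞) ^ 2 * var s ψ < ∞) :
    Summable fun s : ℕ => (s : ℝ) ^ 2 * (var s ψ).toReal := by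
  simpa using ENNReal.summable_toReal hψ.ne

theorem summable_var (hψ : ∑' s : ℕ, (s : ℝ≥0∞) ^ 2 * var s ψ < ∞) :
    Summable fun s : ℕ => (var s ψ).toReal := by
  rw [← summable_nat_add_iff 1]
  refine Summable.of_nonneg_of_le (fun s => ENNReal.toReal_nonneg) (fun s => ?_)
    ((summable_nat_add_iff 1).2 (summable_sq_mul_var hψ))
  have h1 : (1 : ℝ) ≤ ((s + 1 : ℕ) : ℝ) ^ 2 :=
    one_le_pow₀ (by exact_mod_cast Nat.succ_le_succ s.zero_le)
  exact le_mul_of_one_le_left ENNReal.toReal_nonneg h1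

/-- The tail `∑_{k ≥ m} 3 var_k ψ`. The factor `3` makes it a common tail of `ψ` and of all its
approximants. -/
noncomputable def tail (ψ : (ℕ → A) → ℝ) (m : ℕ) : ℝ := ∑' k, 3 * (var (k + m) ψ).toReal

theorem tail_nonneg (m : ℕ) : 0 ≤ tail ψ m :=
  tsum_nonneg fun _ => mul_nonneg (by norm_num) ENNReal.toReal_nonneg

theorem tail_sub_tail_succ (hψ : ∑' s : ℕ, (s : ℝ≥0∞) ^ 2 * var s ψ < ∞) (m : ℕ) :
    tail ψ m - tail ψ (m + 1) = 3 * (var m ψ).toReal := by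
  have h1 : Summable fun k => 3 * (var (k + m) ψ).toReal :=
    ((summable_nat_add_iff m).2 (summable_var hψ)).mul_left 3
  rw [tail, h1.tsum_eq_zero_add, tail, zero_add]
  simp only [add_right_comm _ 1 m, add_assoc]
  ring

theorem tendsto_tail : Tendsto (tail ψ) atTop (𝓝 0) :=
  tendsto_sum_nat_add fun k => 3 * (var k ψ).toReal

variable [Fintype A]

theorem hasTail_tail (hψ : ∑' s : ℕ, (s : ℝ≥0∞) ^ 2 * var s ψ < ∞) : HasTail ψ (tail ψ) where
  nonneg := tail_nonneg
  abs_sub_le m x y hxy := by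
    rw [tail_sub_tail_succ hψ]
    have h1 := abs_sub_le_var (var_ne_top hψ m) fun i hi => hxy i (by omega)
    have h2 : 0 ≤ (var m ψ).toReal := ENNReal.toReal_nonneg
    linarith

theorem IsApproximant.abs_sub_le (hψ : ∑' s : ℕ, (s : ℝ≥0∞) ^ 2 * var s ψ < ∞) {r : ℕ}
    {χ : (ℕ → A) → ℝ} (h : IsApproximant r ψ χ) (z : ℕ → A) :
    |ψ z - χ z| ≤ (var r ψ).toReal := by
  rw [← ENNReal.ofReal_le_iff_le_toReal (var_ne_top hψ r)]
  exact h.2 z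

theorem IsApproximant.hasTail (hψ : ∑' s : ℕ, (s : ℝ≥0∞) ^ 2 * var s ψ < ∞) {r : ℕ}
    {χ : (ℕ → A) → ℝ} (h : IsApproximant r ψ χ) : HasTail χ (tail ψ) where
  nonneg := tail_nonneg
  abs_sub_le m x y hxy := by
    rw [tail_sub_tail_succ hψ]
    rcases le_or_gt r m with hrm | hrm
    · rw [h.1 x y fun i hi => hxy i (by omega), sub_self, abs_zero]
      exact mul_nonneg (by norm_num) ENNReal.toReal_nonneg
    · have h1 := abs_sub_le_var (var_ne_top hψ m) fun i hi => hxy i (by omega)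
      have h2 : (var r ψ).toReal ≤ (var m ψ).toReal := by
        refine ENNReal.toReal_mono (var_ne_top hψ m) ?_
        refine iSup_mono fun x => iSup_mono fun y => iSup_le fun hxy => ?_
        exact le_iSup_of_le (fun i hi => hxy i (by omega)) le_rfl
      have h3 := abs_le.1 (h.abs_sub_le hψ x)
      have h4 := abs_le.1 (h.abs_sub_le hψ y)
      rw [abs_le] at h1 ⊢
      constructor <;> linarith [h1.1, h1.2, h3.1, h3.2, h4.1, h4.2]

theorem tendsto_approximant (hψ : ∑' s : ℕ, (s : ℝ≥0∞) ^ 2 * var s ψ < ∞)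
    {χ : ℕ → (ℕ → A) → ℝ} (h : ∀ r, IsApproximant (r + 1) ψ (χ r)) (z : ℕ → A) :
    Tendsto (fun r => χ r z) atTop (𝓝 (ψ z)) := by
  rw [tendsto_iff_dist_tendsto_zero]
  refine squeeze_zero (fun _ => dist_nonneg) (fun r => ?_)
    ((tendsto_add_atTop_iff_nat 1).2 (summable_var hψ).tendsto_atTop_zero)
  rw [dist_comm, Real.dist_eq]
  exact (h r).abs_sub_le hψ z

end Variation

/-! ### Continuity of the measure in the potential -/

section Continuity

variable {A : Type*} {ψ : (ℕ → A) → ℝ} {t : ℕ → ℝ}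

theorem tendsto_transferIter {χ : ℕ → (ℕ → A) → ℝ}
    (hχ : ∀ z, Tendsto (fun r => χ r z) atTop (𝓝 (ψ z))) (S : ℕ → Finset A) (n : ℕ)
    {f : ℕ → (ℕ → A) → ℝ} {g : (ℕ → A) → ℝ} (hf : ∀ z, Tendsto (fun r => f r z) atTop (𝓝 (g z)))
    (z : ℕ → A) :
    Tendsto (fun r => transferIter (χ r) S n (f r) z) atTop (𝓝 (transferIter ψ S n g z)) := by
  induction n generalizing z with
  | zero => exact hf z
  | succ n ih =>
    exact tendsto_finsetSum _ fun x _ =>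
      ((Real.continuous_exp.tendsto _).comp (hχ (prepend x z))).mul (ih (prepend x z))

variable [Fintype A]

/-- An approximation of `μ (cylSet S n)` that only involves the potential and `2 N + n` symbols. -/
noncomputable def finiteRatio (ψ : (ℕ → A) → ℝ) (S : ℕ → Finset A) (n N : ℕ) (z : ℕ → A) : ℝ :=
  fullIter ψ N (transferIter ψ S n (fullIter ψ N 1)) z / fullIter ψ (N + n) (fullIter ψ N 1) z

variable [Nonempty A]

theorem tendsto_finiteRatio {χ : ℕ → (ℕ → A) → ℝ}
    (hχ : ∀ z, Tendsto (fun r => χ r z) atTop (𝓝 (ψ z))) (S : ℕ → Finset A) (n N : ℕ)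
    (z : ℕ → A) :
    Tendsto (fun r => finiteRatio (χ r) S n N z) atTop (𝓝 (finiteRatio ψ S n N z)) := by
  have h1 := tendsto_transferIter hχ (fun _ => Finset.univ) N
    (f := fun _ => 1) (g := 1) fun z => tendsto_const_nhds
  refine (tendsto_transferIter hχ _ N (tendsto_transferIter hχ S n h1) z).div
    (tendsto_transferIter hχ _ (N + n) h1 z) ?_
  exact (transferIter_pos (fun _ => Finset.univ_nonempty) _
    (transferIter_pos (fun _ => Finset.univ_nonempty) _ fun _ => one_pos) z).ne'

variable [MeasurableSpace A]

/-- The error of `finiteRatio` is bounded in terms of the tail alone: replacing `h` by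
`l ^ (-N) L^N 1` costs the first term, evaluating the limit in `IsCompatible` at time `N` the second. -/
theorem IsCompatible.abs_finiteRatio_sub_le (hψ : HasTail ψ t)
    (ht0 : Tendsto t atTop (𝓝 0)) {l : ℝ} {h : (ℕ → A) → ℝ} (H : IsEigen ψ t l h)
    {μ : Measure (ℕ → A)} (hμ : IsCompatible ψ l h μ) (S : ℕ → Finset A) (n N r : ℕ)
    (z : ℕ → A) (hη : Real.exp (t 0) * memoryRate t N r ≤ 1 / 2) :
    |finiteRatio ψ S n N z - μ.real (cylSet S n)| ≤
      4 * (Real.exp (t 0) * memoryRate t N r) + memoryRate t N r := by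
  have hl := H.eigenvalue_pos
  set δ := memoryRate t N r with hδ
  have hδ0 : 0 ≤ δ := memoryRate_nonneg hψ.nonneg N r
  set η := Real.exp (t 0) * δ with hη'
  have hη0 : 0 ≤ η := by positivity
  obtain ⟨y, hy, hyb⟩ := hψ.exists_ratio_limit ht0 (fun _ => Finset.univ_nonempty)
    (H.regular.transferIter hψ S n) H.regular H.pos (pow_pos hl n) (H.transferIter_le S n)
  have hy' : y = l ^ n * μ.real (cylSet S n) := tendsto_nhds_unique (hy z) (hμ S n z)
  have h1 := hyb N N r z le_rfl
  set w := (l ^ N)⁻¹ • fullIter ψ N 1 with hw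
  have hw0 : ∀ x, 0 < w x := fun x => mul_pos (inv_pos.2 (pow_pos hl N))
    (transferIter_pos (fun _ => Finset.univ_nonempty) N (fun _ => one_pos) x)
  have hlow : (1 - η) • w ≤ h := fun x => by
    have := (abs_le.1 (H.approx N r x)).1
    simp only [hw, Pi.smul_apply, smul_eq_mul]
    linarith
  have hupp : h ≤ (1 + η) • w := fun x => by
    have := (abs_le.1 (H.approx N r x)).2
    simp only [hw, Pi.smul_apply, smul_eq_mul]
    linarith
  -- `p / q` and `p' / q'` are the two quotients to compare
  set p := fullIter ψ N (transferIter ψ S n h) z with hp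
  set q := fullIter ψ (N + n) h z with hq
  set p' := fullIter ψ N (transferIter ψ S n w) z with hp'
  set q' := fullIter ψ (N + n) w z with hq'
  have hq'0 : 0 < q' := transferIter_pos (fun _ => Finset.univ_nonempty) _ hw0 z
  have hp'0 : 0 ≤ p' := transferIter_nonneg _ _ (transferIter_nonneg _ _ fun x => (hw0 x).le) z
  have hpq' : p' ≤ q' := by
    rw [hp', hq', add_comm, fullIter_add]
    exact transferIter_mono _ N (transferIter_le_fullIter S n fun x => (hw0 x).le) z
  have e1 : (1 - η) * p' ≤ p := by
    have := transferIter_mono (ψ := ψ) (fun _ => Finset.univ) N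
      (transferIter_mono (ψ := ψ) S n hlow) z
    simpa using this
  have e2 : p ≤ (1 + η) * p' := by
    have := transferIter_mono (ψ := ψ) (fun _ => Finset.univ) N
      (transferIter_mono (ψ := ψ) S n hupp) z
    simpa using this
  have e3 : (1 - η) * q' ≤ q := by
    have := transferIter_mono (ψ := ψ) (fun _ => Finset.univ) (N + n) hlow z
    simpa using this
  have e4 : q ≤ (1 + η) * q' := by
    have := transferIter_mono (ψ := ψ) (fun _ => Finset.univ) (N + n) hupp z
    simpa using this
  have hq0 : 0 < q := (mul_pos (by linarith) hq'0).trans_le e3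
  have hR : finiteRatio ψ S n N z = p' / q' := by
    have hl' : (l ^ N)⁻¹ ≠ 0 := inv_ne_zero (pow_pos hl N).ne'
    rw [finiteRatio, hp', hq', hw]
    simp only [map_smul, Pi.smul_apply, smul_eq_mul]
    rw [mul_div_mul_left _ _ hl']
  have hX : |p / q - μ.real (cylSet S n)| ≤ δ := by
    have e5 : transferIter ψ (fun _ => Finset.univ) N (transferIter ψ S n h) z /
        transferIter ψ (fun _ => Finset.univ) N h z - y =
        l ^ n * (p / q - μ.real (cylSet S n)) := by
      have e6 : q = l ^ n * fullIter ψ N h z := by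
        rw [hq, H.fullIter_eq, H.fullIter_eq, Pi.smul_apply, Pi.smul_apply, smul_eq_mul,
          smul_eq_mul, pow_add]
        ring
      have e7 : fullIter ψ N h z ≠ 0 :=
        (transferIter_pos (fun _ => Finset.univ_nonempty) _ H.pos z).ne'
      have e8 := (pow_pos hl n).ne'
      rw [hy', e6]
      change p / fullIter ψ N h z - _ = _
      field_simp
    rw [e5, abs_mul, abs_of_pos (pow_pos hl n)] at h1
    exact le_of_mul_le_mul_left h1 (pow_pos hl n)
  have hY : |p' / q' - p / q| ≤ 4 * η := by
    have e5 : p' / q' - p / q = (p' * q - p * q') / (q' * q) := by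
      field_simp
    rw [e5, abs_div, abs_of_pos (mul_pos hq'0 hq0), div_le_iff₀ (mul_pos hq'0 hq0)]
    have e6 : q' ≤ 2 * q := by
      have := mul_le_mul_of_nonneg_right hη hq'0.le
      linarith
    have e7 : |p' * q - p * q'| ≤ 2 * η * p' * q' := by
      rw [abs_le]
      have a1 := mul_le_mul_of_nonneg_left e3 hp'0
      have a2 := mul_le_mul_of_nonneg_left e4 hp'0
      have a3 := mul_le_mul_of_nonneg_right e1 hq'0.le
      have a4 := mul_le_mul_of_nonneg_right e2 hq'0.le
      constructor <;> linarith
    calc _ ≤ 2 * η * p' * q' := e7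
      _ ≤ 2 * η * q' * (2 * q) := by gcongr
      _ = 4 * η * (q' * q) := by ring
  rw [hR]
  calc _ = |(p' / q' - p / q) + (p / q - μ.real (cylSet S n))| := by ring_nf
    _ ≤ _ := (abs_add_le _ _).trans (add_le_add hY hX)

/-- Weak continuity: if potentials with a common tail converge pointwise, then so do the masses that
the associated measures give to cylinders. The approximations by `finiteRatio` are uniform over
the potentials and each of them is continuous in the potential. -/
theorem tendsto_real_cylSet (hψ : HasTail ψ t) (ht0 : Tendsto t atTop (𝓝 0))
    {l : ℝ} {h : (ℕ → A) → ℝ} (H : IsEigen ψ t l h) {μ : Measure (ℕ → A)}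
    (hμ : IsCompatible ψ l h μ) {χ : ℕ → (ℕ → A) → ℝ} (hχt : ∀ r, HasTail (χ r) t)
    (hχ : ∀ z, Tendsto (fun r => χ r z) atTop (𝓝 (ψ z))) {l' : ℕ → ℝ} {h' : ℕ → (ℕ → A) → ℝ}
    (H' : ∀ r, IsEigen (χ r) t (l' r) (h' r)) {μ' : ℕ → Measure (ℕ → A)}
    (hμ' : ∀ r, IsCompatible (χ r) (l' r) (h' r) (μ' r)) (S : ℕ → Finset A) (n : ℕ) :
    Tendsto (fun r => (μ' r).real (cylSet S n)) atTop (𝓝 (μ.real (cylSet S n))) := by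
  have a : ℕ → A := fun _ => Classical.arbitrary A
  rw [Metric.tendsto_nhds]
  intro ε hε
  have hr := tendsto_memoryRate_sqrt hψ.nonneg ht0
  have hr1 : Tendsto (fun N => Real.exp (t 0) * memoryRate t N (Nat.sqrt N)) atTop (𝓝 0) := by
    simpa using hr.const_mul (Real.exp (t 0))
  have hr2 : Tendsto (fun N => 4 * (Real.exp (t 0) * memoryRate t N (Nat.sqrt N)) +
      memoryRate t N (Nat.sqrt N)) atTop (𝓝 0) := by
    simpa using (hr1.const_mul 4).add hr
  obtain ⟨N, hN1, hN2⟩ := ((hr1.eventually (gt_mem_nhds (by norm_num : (0 : ℝ) < 1 / 2))).and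
    (hr2.eventually (gt_mem_nhds (by positivity : 0 < ε / 3)))).exists
  have h1 := hμ.abs_finiteRatio_sub_le hψ ht0 H S n N _ a hN1.le
  filter_upwards [(Metric.tendsto_nhds.1 (tendsto_finiteRatio hχ S n N a)) (ε / 3)
    (by positivity)] with r hr3
  have h2 := (hμ' r).abs_finiteRatio_sub_le (hχt r) ht0 (H' r) S n N _ a hN1.le
  rw [Real.dist_eq, abs_lt] at *
  rw [abs_le] at h1 h2
  constructor <;> linarith [h1.1, h1.2, h2.1, h2.2, hr3.1, hr3.2]

end Continuity

/-! ### Decay rates -/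

section Rates

theorem exists_exp_neg_mul_rpow_le {κ β : ℝ} (hκ : 0 < κ) (hβ : 0 < β) (p : ℝ) :
    ∃ C : ℝ, 0 < C ∧ ∀ n : ℕ, 1 ≤ n → Real.exp (-κ * (n : ℝ) ^ β) ≤ C * (n : ℝ) ^ (-p) := by
  obtain ⟨k, hk⟩ := exists_nat_ge (p / β)
  refine ⟨k.factorial / κ ^ k, by positivity, fun n hn => ?_⟩
  have hn0 : (0 : ℝ) < n := by exact_mod_cast hn
  have hn1 : (1 : ℝ) ≤ n := by exact_mod_cast hn
  have hx : 0 < κ * (n : ℝ) ^ β := by positivity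
  have h1 := Real.pow_div_factorial_le_exp (κ * (n : ℝ) ^ β) hx.le k
  have h2 : (n : ℝ) ^ p ≤ ((n : ℝ) ^ β) ^ k := by
    rw [← Real.rpow_natCast, ← Real.rpow_mul hn0.le]
    refine Real.rpow_le_rpow_of_exponent_le hn1 ?_
    rwa [div_le_iff₀ hβ, mul_comm] at hk
  rw [neg_mul, Real.exp_neg, Real.rpow_neg hn0.le]
  have h3 : 0 < (n : ℝ) ^ p := by positivity
  calc (Real.exp (κ * (n : ℝ) ^ β))⁻¹ ≤ ((κ * (n : ℝ) ^ β) ^ k / k.factorial)⁻¹ :=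
        inv_anti₀ (by positivity) h1
    _ = k.factorial / κ ^ k * (((n : ℝ) ^ β) ^ k)⁻¹ := by rw [mul_pow]; field_simp
    _ ≤ _ := by gcongr

theorem half_rpow_le_floor {α : ℝ} (hα : 0 ≤ α) {n : ℕ} (hn : 1 ≤ n) :
    1 ≤ ⌊(n : ℝ) ^ α⌋₊ ∧ (n : ℝ) ^ α / 2 ≤ (⌊(n : ℝ) ^ α⌋₊ : ℝ) := by
  have hn1 : (1 : ℝ) ≤ n := by exact_mod_cast hn
  have h1 : (1 : ℝ) ≤ (n : ℝ) ^ α := Real.one_le_rpow hn1 hα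
  have h2 : 1 ≤ ⌊(n : ℝ) ^ α⌋₊ := by rwa [Nat.one_le_floor_iff]
  have h3 := Nat.lt_floor_add_one ((n : ℝ) ^ α)
  have h4 : (1 : ℝ) ≤ (⌊(n : ℝ) ^ α⌋₊ : ℝ) := by exact_mod_cast h2
  exact ⟨h2, by linarith⟩

/-- The memory rate for blocks of length `n ^ α`, of which there are about `n ^ (1 - α)`. -/
theorem memoryRate_floor_le {t : ℕ → ℝ} (ht : ∀ m, 0 ≤ t m) {α : ℝ} (hα : 0 ≤ α) {n : ℕ}
    (hn : 1 ≤ n) :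
    memoryRate t n ⌊(n : ℝ) ^ α⌋₊ ≤ Real.exp (Real.exp (-(2 * t 0))) *
      Real.exp (-Real.exp (-(2 * t 0)) * (n : ℝ) ^ (1 - α)) +
      2 * Real.exp (4 * t 0) * t ⌊(n : ℝ) ^ α⌋₊ := by
  have hn0 : (0 : ℝ) < n := by exact_mod_cast hn
  obtain ⟨hr1, -⟩ := half_rpow_le_floor hα hn
  set r := ⌊(n : ℝ) ^ α⌋₊ with hr
  set κ := Real.exp (-(2 * t 0)) with hκ
  have hκ0 : 0 < κ := Real.exp_pos _
  unfold memoryRate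
  rw [← hκ]
  have h0 : 0 ≤ 1 - κ := (one_sub_exp_neg_mem ht).1
  have h1 : 1 - κ ≤ Real.exp (-κ) := by linarith [Real.add_one_le_exp (-κ)]
  have h2 : (n : ℝ) ^ (1 - α) ≤ (n / r : ℕ) + 1 := by
    have h3 : (n : ℝ) < r * ((n / r : ℕ) + 1) := by
      exact_mod_cast Nat.lt_mul_div_succ n hr1
    have h4 : (r : ℝ) ≤ (n : ℝ) ^ α := Nat.floor_le (by positivity)
    rw [Real.rpow_sub hn0, Real.rpow_one, div_le_iff₀ (by positivity), mul_comm]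
    exact h3.le.trans (mul_le_mul_of_nonneg_right h4 (by positivity))
  refine add_le_add_left ?_ _
  calc (1 - κ) ^ (n / r) ≤ Real.exp (-κ) ^ (n / r) := pow_le_pow_left₀ h0 h1 _
    _ = Real.exp (-κ * (n / r : ℕ)) := by rw [← Real.exp_nat_mul, mul_comm]
    _ ≤ Real.exp (κ + -κ * (n : ℝ) ^ (1 - α)) := by
      rw [Real.exp_le_exp]
      have := mul_le_mul_of_nonneg_left h2 hκ0.le
      linarith
    _ = _ := Real.exp_add _ _

theorem exists_memoryRate_le_rpow {t : ℕ → ℝ} (ht : ∀ m, 0 ≤ t m) {K p α : ℝ} (hK : 0 ≤ K)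
    (hp : 0 ≤ p) (hα : 0 ≤ α) (hα1 : α < 1)
    (htK : ∀ r : ℕ, 1 ≤ r → t r ≤ K * (r : ℝ) ^ (-p)) :
    ∃ C : ℝ, 0 < C ∧ ∀ n : ℕ, 1 ≤ n →
      memoryRate t n ⌊(n : ℝ) ^ α⌋₊ ≤ C * (n : ℝ) ^ (-(α * p)) := by
  obtain ⟨C, hC, hb⟩ := exists_exp_neg_mul_rpow_le (Real.exp_pos (-(2 * t 0)))
    (sub_pos.2 hα1) (α * p)
  refine ⟨Real.exp (Real.exp (-(2 * t 0))) * C + 2 * Real.exp (4 * t 0) * (K * 2 ^ p),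
    by positivity, fun n hn => ?_⟩
  have hn0 : (0 : ℝ) < n := by exact_mod_cast hn
  obtain ⟨hr1, hr2⟩ := half_rpow_le_floor hα hn
  have h1 : t ⌊(n : ℝ) ^ α⌋₊ ≤ K * 2 ^ p * (n : ℝ) ^ (-(α * p)) := by
    refine (htK _ hr1).trans ?_
    rw [mul_assoc]
    refine mul_le_mul_of_nonneg_left ?_ hK
    calc (⌊(n : ℝ) ^ α⌋₊ : ℝ) ^ (-p) ≤ ((n : ℝ) ^ α / 2) ^ (-p) :=
          Real.rpow_le_rpow_of_nonpos (by positivity) hr2 (by linarith)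
      _ = _ := by
        rw [Real.div_rpow (by positivity) (by norm_num), ← Real.rpow_mul hn0.le,
          Real.rpow_neg (by norm_num : (0 : ℝ) ≤ 2), mul_neg, div_inv_eq_mul, mul_comm]
  calc _ ≤ _ := memoryRate_floor_le ht hα hn
    _ ≤ Real.exp (Real.exp (-(2 * t 0))) * (C * (n : ℝ) ^ (-(α * p))) +
        2 * Real.exp (4 * t 0) * (K * 2 ^ p * (n : ℝ) ^ (-(α * p))) := by
      gcongr
      exact hb n hn
    _ = _ := by ring

theorem exists_memoryRate_le_exp {t : ℕ → ℝ} (ht : ∀ m, 0 ≤ t m) {K c γ : ℝ} (hK : 0 ≤ K)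
    (hc : 0 < c) (hγ : 0 < γ) (htK : ∀ r : ℕ, t r ≤ K * Real.exp (-c * (r : ℝ) ^ γ)) :
    ∃ C d : ℝ, 0 < C ∧ 0 < d ∧ ∀ n : ℕ, 1 ≤ n →
      memoryRate t n ⌊(n : ℝ) ^ (1 / (1 + γ))⌋₊ ≤
        C * Real.exp (-d * (n : ℝ) ^ (γ / (1 + γ))) := by
  set κ := Real.exp (-(2 * t 0)) with hκ
  have hκ0 : 0 < κ := Real.exp_pos _
  refine ⟨Real.exp κ + 2 * Real.exp (4 * t 0) * K, min κ (c * (1 / 2) ^ γ), by positivity,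
    by positivity, fun n hn => ?_⟩
  have hn0 : (0 : ℝ) < n := by exact_mod_cast hn
  have hα : (0 : ℝ) ≤ 1 / (1 + γ) := by positivity
  obtain ⟨-, hr2⟩ := half_rpow_le_floor hα hn
  have hα' : 1 - 1 / (1 + γ) = γ / (1 + γ) := by field_simp; ring
  set y := (n : ℝ) ^ (γ / (1 + γ)) with hy
  have hy0 : 0 < y := by positivity
  have h1 : Real.exp (-κ * y) ≤ Real.exp (-min κ (c * (1 / 2) ^ γ) * y) := by
    rw [Real.exp_le_exp]
    exact mul_le_mul_of_nonneg_right (neg_le_neg (min_le_left _ _)) hy0.le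
  have h2 : t ⌊(n : ℝ) ^ (1 / (1 + γ))⌋₊ ≤ K * Real.exp (-min κ (c * (1 / 2) ^ γ) * y) := by
    refine (htK _).trans (mul_le_mul_of_nonneg_left ?_ hK)
    rw [Real.exp_le_exp]
    have h3 : (1 / 2) ^ γ * y ≤ (⌊(n : ℝ) ^ (1 / (1 + γ))⌋₊ : ℝ) ^ γ := by
      calc (1 / 2) ^ γ * y = ((n : ℝ) ^ (1 / (1 + γ)) / 2) ^ γ := by
            rw [div_eq_mul_one_div ((n : ℝ) ^ (1 / (1 + γ))), Real.mul_rpow (by positivity)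
              (by norm_num), ← Real.rpow_mul hn0.le, hy, mul_comm, one_div_mul_eq_div]
        _ ≤ _ := Real.rpow_le_rpow (by positivity) hr2 hγ.le
    have h4 := mul_le_mul_of_nonneg_right (min_le_right κ (c * (1 / 2) ^ γ)) hy0.le
    have h5 := mul_le_mul_of_nonneg_left h3 hc.le
    linarith
  calc _ ≤ _ := memoryRate_floor_le ht hα hn
    _ ≤ Real.exp κ * Real.exp (-min κ (c * (1 / 2) ^ γ) * y) + 2 * Real.exp (4 * t 0) *
        (K * Real.exp (-min κ (c * (1 / 2) ^ γ) * y)) := by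
      rw [hα', ← hκ]
      gcongr
    _ = _ := by ring

variable {A : Type*} {ψ : (ℕ → A) → ℝ}

theorem tail_le_tsum {f : ℕ → ℝ} {K : ℝ} (hf : Summable f) {r : ℕ}
    (h : ∀ k, (var (k + r) ψ).toReal ≤ K * f k) : tail ψ r ≤ 3 * (K * ∑' k, f k) := by
  rw [tail, ← tsum_mul_left, ← tsum_mul_left]
  have h1 : Summable fun k => 3 * (K * f k) := (hf.mul_left K).mul_left 3
  have h2 : ∀ k, 3 * (var (k + r) ψ).toReal ≤ 3 * (K * f k) := fun k => by linarith [h k]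
  exact Summable.tsum_le_tsum h2
    (Summable.of_nonneg_of_le (fun k => mul_nonneg (by norm_num) ENNReal.toReal_nonneg) h2 h1) h1

theorem exists_tail_le_sq (hψ : ∑' s : ℕ, (s : ℝ≥0∞) ^ 2 * var s ψ < ∞) :
    ∃ K : ℝ, 0 ≤ K ∧ ∀ r : ℕ, 1 ≤ r → tail ψ r ≤ K * (r : ℝ) ^ (-(2 : ℝ)) := by
  have hs := summable_sq_mul_var hψ
  refine ⟨3 * ∑' s : ℕ, (s : ℝ) ^ 2 * (var s ψ).toReal, by positivity, fun r hr => ?_⟩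
  have hr0 : (0 : ℝ) < r := by exact_mod_cast hr
  set f : ℕ → ℝ := fun s => (s : ℝ) ^ 2 * (var s ψ).toReal with hf
  have hf0 : ∀ s, 0 ≤ f s := fun s => mul_nonneg (by positivity) ENNReal.toReal_nonneg
  have h1 := tail_le_tsum (ψ := ψ) (K := (r : ℝ) ^ (-(2 : ℝ))) (f := fun k => f (k + r))
    ((summable_nat_add_iff r).2 hs) (r := r) fun k => by
      have hkr : (r : ℝ) ^ 2 ≤ ((k + r : ℕ) : ℝ) ^ 2 := by
        have : (r : ℝ) ≤ ((k + r : ℕ) : ℝ) := by exact_mod_cast Nat.le_add_left r k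
        gcongr
      rw [Real.rpow_neg hr0.le, Real.rpow_ofNat, le_inv_mul_iff₀ (by positivity)]
      exact mul_le_mul_of_nonneg_right hkr ENNReal.toReal_nonneg
  have h2 : ∑' k, f (k + r) ≤ ∑' s, f s := by
    have h3 := hs.sum_add_tsum_nat_add r
    have h4 : 0 ≤ ∑ i ∈ Finset.range r, f i := Finset.sum_nonneg fun i _ => hf0 i
    linarith
  calc _ ≤ _ := h1
    _ ≤ 3 * ((r : ℝ) ^ (-(2 : ℝ)) * ∑' s, f s) := by gcongr
    _ = _ := by ring

theorem exists_tail_le_exp {C c γ : ℝ} (hC : 0 < C) (hc : 0 < c) (hγ : 0 < γ)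
    (h : ∀ n : ℕ, var n ψ ≤ ENNReal.ofReal (C * Real.exp (-c * (n : ℝ) ^ γ))) :
    ∃ K : ℝ, 0 ≤ K ∧ ∀ r : ℕ, tail ψ r ≤ K * Real.exp (-(c / 2) * (r : ℝ) ^ γ) := by
  have hsum : Summable fun k : ℕ => Real.exp (-(c / 2) * (k : ℝ) ^ γ) := by
    obtain ⟨M, -, hM⟩ := exists_exp_neg_mul_rpow_le (half_pos hc) hγ 2
    have h2 : Summable fun k : ℕ => M * (k : ℝ) ^ (-(2 : ℝ)) :=
      (Real.summable_nat_rpow.2 (by norm_num)).mul_left M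
    refine Summable.of_norm_bounded_eventually_nat h2 ?_
    filter_upwards [eventually_ge_atTop 1] with k hk
    rw [Real.norm_of_nonneg (Real.exp_pos _).le]
    exact hM k hk
  refine ⟨3 * (C * ∑' k : ℕ, Real.exp (-(c / 2) * (k : ℝ) ^ γ)), by positivity, fun r => ?_⟩
  have h1 := tail_le_tsum (ψ := ψ) (K := C * Real.exp (-(c / 2) * (r : ℝ) ^ γ))
    hsum (r := r) fun k => by
      have h2 : (var (k + r) ψ).toReal ≤ C * Real.exp (-c * ((k + r : ℕ) : ℝ) ^ γ) :=
        ENNReal.toReal_le_of_le_ofReal (by positivity) (h (k + r))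
      refine h2.trans ?_
      rw [mul_assoc, ← Real.exp_add]
      refine mul_le_mul_of_nonneg_left (Real.exp_le_exp.2 ?_) hC.le
      have h3 : (k : ℝ) ^ γ ≤ ((k + r : ℕ) : ℝ) ^ γ :=
        Real.rpow_le_rpow (by positivity) (by push_cast; linarith [r.cast_nonneg (α := ℝ)]) hγ.le
      have h4 : (r : ℝ) ^ γ ≤ ((k + r : ℕ) : ℝ) ^ γ :=
        Real.rpow_le_rpow (by positivity) (by push_cast; linarith [k.cast_nonneg (α := ℝ)]) hγ.le
      nlinarith
  calc _ ≤ _ := h1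
    _ = _ := by ring

theorem exists_tail_le_rpow {C q : ℝ} (hC : 0 < C) (hq : 2 < q)
    (h : ∀ n : ℕ, 1 ≤ n → var n ψ ≤ ENNReal.ofReal (C * (n : ℝ) ^ (-q))) :
    ∃ K : ℝ, 0 ≤ K ∧ ∀ r : ℕ, 1 ≤ r → tail ψ r ≤ K * (r : ℝ) ^ (-(q - 2)) := by
  have hsum : Summable fun k : ℕ => ((k + 1 : ℕ) : ℝ) ^ (-(2 : ℝ)) :=
    (summable_nat_add_iff 1).2 (Real.summable_nat_rpow.2 (by norm_num))
  refine ⟨3 * (C * ∑' k : ℕ, ((k + 1 : ℕ) : ℝ) ^ (-(2 : ℝ))), by positivity, fun r hr => ?_⟩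
  have hr0 : (0 : ℝ) < r := by exact_mod_cast hr
  have hr1 : (1 : ℝ) ≤ r := by exact_mod_cast hr
  have h1 := tail_le_tsum (ψ := ψ) (K := C * (r : ℝ) ^ (-(q - 2)))
    hsum (r := r) fun k => by
      have hk : (0 : ℝ) ≤ k := k.cast_nonneg
      have h2 : (var (k + r) ψ).toReal ≤ C * ((k + r : ℕ) : ℝ) ^ (-q) :=
        ENNReal.toReal_le_of_le_ofReal (by positivity) (h (k + r) (by omega))
      refine h2.trans ?_
      have hkr : (0 : ℝ) < ((k + r : ℕ) : ℝ) := by push_cast; linarith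
      rw [mul_assoc, show -q = -(q - 2) + -2 by ring, Real.rpow_add hkr]
      refine mul_le_mul_of_nonneg_left (mul_le_mul ?_ ?_ (by positivity) (by positivity)) hC.le
      · exact Real.rpow_le_rpow_of_nonpos hr0 (by push_cast; linarith) (by linarith)
      · exact Real.rpow_le_rpow_of_nonpos (by positivity) (by push_cast; linarith) (by norm_num)
  calc _ ≤ _ := h1
    _ = _ := by ring

end Rates

/-! ### The Gibbs measure and its projection -/

section Main

variable {A : Type*} [Fintype A] [Nonempty A] [TopologicalSpace A] [DiscreteTopology A]
  [MeasurableSpace A] [DiscreteMeasurableSpace A] {ψ : (ℕ → A) → ℝ} {t : ℕ → ℝ}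

theorem HasTail.existsUnique_isGibbs (hψ : HasTail ψ t) (ht0 : Tendsto t atTop (𝓝 0)) :
    ∃! μ : Measure (ℕ → A), IsGibbs μ ψ := by
  obtain ⟨l, h, H⟩ := hψ.exists_isEigen ht0
  obtain ⟨μ, hμ1, hμ⟩ := H.exists_isCompatible hψ ht0
  have hG : IsGibbs μ ψ := ⟨_, hμ.isGibbsWith hψ ht0 H⟩
  exact ⟨μ, hG, fun ρ hρ => hψ.gibbs_unique hG hρ⟩

theorem HasTail.exists_isCompatible_of_isGibbs (hψ : HasTail ψ t)
    (ht0 : Tendsto t atTop (𝓝 0)) {μ : Measure (ℕ → A)} (hG : IsGibbs μ ψ) :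
    IsProbabilityMeasure μ ∧ ∃ l h, IsEigen ψ t l h ∧ IsCompatible ψ l h μ := by
  obtain ⟨l, h, H⟩ := hψ.exists_isEigen ht0
  obtain ⟨ρ, hρ1, hρ⟩ := H.exists_isCompatible hψ ht0
  obtain rfl : μ = ρ := hψ.gibbs_unique ⟨_, hρ.isGibbsWith hψ ht0 H⟩ hG
  exact ⟨hρ1, l, h, H, hρ⟩

end Main

section Decay

variable {B : Type*} {φ : (ℕ → B) → ℝ}

theorem summable_memoryRate {t : ℕ → ℝ} (ht : ∀ m, 0 ≤ t m) {K : ℝ} (hK : 0 ≤ K)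
    (htK : ∀ r : ℕ, 1 ≤ r → t r ≤ K * (r : ℝ) ^ (-(2 : ℝ))) :
    Summable fun n : ℕ => memoryRate t n ⌊(n : ℝ) ^ (2 / 3 : ℝ)⌋₊ := by
  obtain ⟨C, -, hC⟩ := exists_memoryRate_le_rpow (α := 2 / 3) ht hK (by norm_num) (by norm_num)
    (by norm_num) htK
  have h2 : Summable fun k : ℕ => C * (k : ℝ) ^ (-(2 / 3 * 2) : ℝ) :=
    (Real.summable_nat_rpow.2 (by norm_num)).mul_left C
  refine Summable.of_norm_bounded_eventually_nat h2 ?_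
  filter_upwards [eventually_ge_atTop 1] with n hn
  rw [Real.norm_of_nonneg (memoryRate_nonneg ht _ _)]
  exact hC n hn

theorem exists_var_le_exp {A : Type*} {ψ : (ℕ → A) → ℝ} {K : ℝ} (hK : 0 ≤ K)
    (hφ : ∀ n r, var n φ ≤ ENNReal.ofReal (K * memoryRate (tail ψ) n r))
    {C c γ : ℝ} (hC : 0 < C) (hc : 0 < c) (hγ : 0 < γ)
    (h : ∀ n : ℕ, var n ψ ≤ ENNReal.ofReal (C * Real.exp (-c * (n : ℝ) ^ γ))) :
    ∃ D d : ℝ, C < D ∧ 0 < d ∧ d < c ∧ ∀ n : ℕ, var n φ ≤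
      ENNReal.ofReal (D * Real.exp (-d * (n : ℝ) ^ (γ / (1 + γ)))) := by
  obtain ⟨M, hM, htail⟩ := exists_tail_le_exp hC hc hγ h
  obtain ⟨C', d', hC', hd', hb⟩ := exists_memoryRate_le_exp (tail_nonneg (ψ := ψ)) hM
    (half_pos hc) hγ htail
  have h00 := memoryRate_nonneg (tail_nonneg (ψ := ψ)) 0 0
  have h01 : 0 ≤ K * C' := by positivity
  have h02 : 0 ≤ K * memoryRate (tail ψ) 0 0 := by positivity
  refine ⟨C + 1 + K * C' + K * memoryRate (tail ψ) 0 0, min d' (c / 2), by linarith,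
    by positivity, (min_le_right _ _).trans_lt (half_lt_self hc), fun n => ?_⟩
  rcases Nat.eq_zero_or_pos n with rfl | hn
  · refine (hφ 0 0).trans (ENNReal.ofReal_le_ofReal ?_)
    rw [Nat.cast_zero, Real.zero_rpow (by positivity), mul_zero, Real.exp_zero, mul_one]
    linarith
  · refine (hφ n _).trans (ENNReal.ofReal_le_ofReal
      ((mul_le_mul_of_nonneg_left (hb n hn) hK).trans ?_))
    rw [← mul_assoc]
    refine mul_le_mul (by linarith) (Real.exp_le_exp.2 ?_) (Real.exp_pos _).le (by linarith)
    exact mul_le_mul_of_nonneg_right (neg_le_neg (min_le_left _ _)) (by positivity)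

theorem exists_var_le_rpow {A : Type*} {ψ : (ℕ → A) → ℝ} {K : ℝ} (hK : 0 ≤ K)
    (hφ : ∀ n r, var n φ ≤ ENNReal.ofReal (K * memoryRate (tail ψ) n r))
    {C q ε : ℝ} (hC : 0 < C) (hε : 0 < ε) (hεq : ε < q - 3)
    (h : ∀ n : ℕ, 1 ≤ n → var n ψ ≤ ENNReal.ofReal (C * (n : ℝ) ^ (-q))) :
    ∃ D : ℝ, C < D ∧ ∀ n : ℕ, 1 ≤ n → var n φ ≤
      ENNReal.ofReal (D * (1 / (n : ℝ) ^ (q - 2 - ε))) := by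
  obtain ⟨M, hM, htail⟩ := exists_tail_le_rpow hC (by linarith) h
  have hq2 : 0 < q - 2 := by linarith
  -- blocks of length `n ^ α`, where `α` is chosen so that `α (q - 2) = q - 2 - ε`
  set α := (q - 2 - ε) / (q - 2) with hα
  have hα0 : 0 ≤ α := div_nonneg (by linarith) hq2.le
  have hα1 : α < 1 := by rw [hα, div_lt_one hq2]; linarith
  obtain ⟨C', hC', hb⟩ := exists_memoryRate_le_rpow (tail_nonneg (ψ := ψ)) hM hq2.le hα0 hα1 htail
  have h01 : 0 ≤ K * C' := by positivity
  refine ⟨C + 1 + K * C', by linarith, fun n hn => ?_⟩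
  refine (hφ n _).trans (ENNReal.ofReal_le_ofReal
    ((mul_le_mul_of_nonneg_left (hb n hn) hK).trans ?_))
  rw [hα, div_mul_cancel₀ _ hq2.ne', ← mul_assoc, Real.rpow_neg n.cast_nonneg, one_div]
  exact mul_le_mul_of_nonneg_right (by linarith) (by positivity)

end Decay

end GibbsAmalgamation

theorem theorem4p1 {A B : Type*}
    [Fintype A] [TopologicalSpace A] [DiscreteTopology A]
    [MeasurableSpace A] [DiscreteMeasurableSpace A]
    [Fintype B] [TopologicalSpace B] [DiscreteTopology B]
    [MeasurableSpace B] [DiscreteMeasurableSpace B]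
    (hcard : Fintype.card B < Fintype.card A) (hB : 2 ≤ Fintype.card B)
    (π : A → B) (hπ : Function.Surjective π)
    (ψ : (ℕ → A) → ℝ)
    (hψ : ∑' s : ℕ, (s : ℝ≥0∞) ^ 2 * GibbsAmalgamation.var s ψ < ∞) :
    -- the Gibbs measure of the potential and those of its approximants are well defined
    (∃! μ : Measure (ℕ → A), GibbsAmalgamation.IsGibbs μ ψ) ∧
    (∀ r : ℕ, 1 ≤ r → ∀ χ : (ℕ → A) → ℝ, GibbsAmalgamation.IsApproximant r ψ χ →
      ∃! μ : Measure (ℕ → A), GibbsAmalgamation.IsGibbs μ χ) ∧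
    ∀ μ : Measure (ℕ → A), GibbsAmalgamation.IsGibbs μ ψ →
    ∃ φ : (ℕ → B) → ℝ,
      -- the pushforward is a Gibbs measure with full support for the normalized potential `φ`
      GibbsAmalgamation.IsGibbsWith (μ.map (GibbsAmalgamation.amalgam π)) φ 0 ∧
      GibbsAmalgamation.pressure φ = 0 ∧
      (μ.map (GibbsAmalgamation.amalgam π)).support = Set.univ ∧
      -- `φ` is the double limit over the Markov approximants
      (∀ (χ : ℕ → (ℕ → A) → ℝ) (m : ℕ → Measure (ℕ → A)),
        (∀ r, 1 ≤ r → GibbsAmalgamation.IsApproximant r ψ (χ r)) →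
        (∀ r, 1 ≤ r → GibbsAmalgamation.IsGibbs (m r) (χ r)) →
        ∃ φr : ℕ → (ℕ → B) → ℝ,
          (∀ r, 1 ≤ r → ∀ b : ℕ → B, Tendsto (fun n : ℕ => Real.log
            (((m r).map (GibbsAmalgamation.amalgam π)).real (GibbsAmalgamation.cyl b 0 n) /
              ((m r).map (GibbsAmalgamation.amalgam π)).real (GibbsAmalgamation.cyl b 1 n)))
            atTop (𝓝 (φr r b))) ∧
          ∀ b : ℕ → B, Tendsto (fun r : ℕ => φr r b) atTop (𝓝 (φ b))) ∧
      -- subexponential decay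
      (∀ C c γ : ℝ, 0 < C → 0 < c → 0 < γ → γ < 1 →
        (∀ n : ℕ, GibbsAmalgamation.var n ψ ≤
          ENNReal.ofReal (C * Real.exp (-c * (n : ℝ) ^ γ))) →
        ∃ D d : ℝ, C < D ∧ 0 < d ∧ d < c ∧ ∀ n : ℕ, GibbsAmalgamation.var n φ ≤
          ENNReal.ofReal (D * Real.exp (-d * (n : ℝ) ^ (γ / (1 + γ))))) ∧
      -- polynomial decay
      (∀ C q : ℝ, 0 < C → 3 < q →
        (∀ n : ℕ, 1 ≤ n → GibbsAmalgamation.var n ψ ≤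
          ENNReal.ofReal (C * (n : ℝ) ^ (-q))) →
        ∀ ε : ℝ, 0 < ε → ε < q - 3 →
        ∃ D : ℝ, C < D ∧ ∀ n : ℕ, 1 ≤ n → GibbsAmalgamation.var n φ ≤
          ENNReal.ofReal (D * (1 / (n : ℝ) ^ (q - 2 - ε)))) := by
  open GibbsAmalgamation in
  have hne : Nonempty A := Fintype.card_pos_iff.1 (by omega)
  have hT := hasTail_tail hψ
  have ht0 : Tendsto (tail ψ) atTop (𝓝 0) := tendsto_tail
  have hTχ : ∀ {r : ℕ} {χ : (ℕ → A) → ℝ}, IsApproximant r ψ χ → HasTail χ (tail ψ) :=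
    fun h => h.hasTail hψ
  refine ⟨hT.existsUnique_isGibbs ht0, fun r _ χ hχ => (hTχ hχ).existsUnique_isGibbs ht0,
    fun μ hμG => ?_⟩
  obtain ⟨hμ1, l, h, H, hμ⟩ := hT.exists_isCompatible_of_isGibbs ht0 hμG
  obtain ⟨Q, c, hc, hQ⟩ := hμ.exists_ratio_limit (B := B) hT ht0 H hπ
  have hrate0 := tendsto_memoryRate_sqrt hT.nonneg ht0
  have hlog : ∀ b n r, |Real.log (μ.real (cylSet (fibers π b) (n + 1)) /
      μ.real (cylSet (fibers π (shift b)) n)) - Real.log (Q b)| ≤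
      1 / c * memoryRate (tail ψ) n r := by
    intro b n r
    obtain ⟨h1, h2⟩ := hQ b
    refine (abs_log_sub_log_le hc (h2 n).2.1 h1).trans ?_
    rw [one_div, ← div_eq_inv_mul]
    exact div_le_div_of_nonneg_right ((h2 n).2.2 r) hc.le
  -- the ratio of order `n` only depends on `b_0^n`
  have hosc : ∀ n r x y, (∀ i ≤ n, x i = y i) →
      |Real.log (Q x) - Real.log (Q y)| ≤ 2 / c * memoryRate (tail ψ) n r := by
    intro n r x y hxy
    have h1 := abs_le.1 (hlog x n r)
    have h2 := abs_le.1 (hlog y n r)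
    have e1 : cylSet (fibers π x) (n + 1) = cylSet (fibers π y) (n + 1) :=
      cylSet_fibers_congr fun i hi => hxy i (by omega)
    have e2 : cylSet (fibers π (shift x)) n = cylSet (fibers π (shift y)) n :=
      cylSet_fibers_congr fun i hi => hxy (i + 1) (by omega)
    rw [e1, e2] at h1
    have e3 : 2 / c * memoryRate (tail ψ) n r = 2 * (1 / c * memoryRate (tail ψ) n r) := by ring
    rw [e3, abs_le]
    constructor <;> linarith [h1.1, h1.2, h2.1, h2.2]
  have hvar : ∀ n r, var n (fun b => Real.log (Q b)) ≤
      ENNReal.ofReal (2 / c * memoryRate (tail ψ) n r) := fun n r => var_le_ofReal (hosc n r)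
  have hcont : Continuous fun b => Real.log (Q b) :=
    continuous_of_abs_sub_le (w := fun n => 2 / c * memoryRate (tail ψ) n (Nat.sqrt n))
      (by simpa using hrate0.const_mul (2 / c))
      fun n x y hxy => hosc n _ x y fun i hi => hxy i (by omega)
  obtain ⟨K, hK, htK⟩ := exists_tail_le_sq hψ
  obtain ⟨P, hP⟩ := hμG
  have hgibbs : IsGibbsWith (μ.map (amalgam π)) (fun b => Real.log (Q b)) 0 :=
    isGibbsWith_map hP.invariant hcont
      ((summable_memoryRate tail_nonneg hK htK).mul_left (1 / c))
      (fun b n => ((hQ b).2 n).1) fun b n => hlog b n _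
  refine ⟨fun b => Real.log (Q b), hgibbs, hgibbs.pressure_eq_zero, hgibbs.support_eq_univ,
    fun χ m hχ hm => ?_, ?_, ?_⟩
  · have hex : ∀ r, 1 ≤ r → ∃ (q : (ℕ → B) → ℝ) (l' : ℝ) (h' : (ℕ → A) → ℝ),
        IsEigen (χ r) (tail ψ) l' h' ∧ IsCompatible (χ r) l' h' (m r) ∧ ∀ b, 0 < q b ∧
          ∀ n s, |(m r).real (cylSet (fibers π b) (n + 1)) /
            (m r).real (cylSet (fibers π (shift b)) n) - q b| ≤ memoryRate (tail ψ) n s := by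
      intro r hr
      obtain ⟨hm1, l', h', H', hm'⟩ :=
        (hTχ (hχ r hr)).exists_isCompatible_of_isGibbs ht0 (hm r hr)
      obtain ⟨q, c', hc', hq⟩ := hm'.exists_ratio_limit (B := B) (hTχ (hχ r hr)) ht0 H' hπ
      exact ⟨q, l', h', H', hm', fun b => ⟨hc'.trans_le (hq b).1, fun n s => ((hq b).2 n).2.2 s⟩⟩
    choose! q l' h' H' hm' hq using hex
    refine ⟨fun r b => Real.log (q r b), fun r hr b => ?_, fun b => ?_⟩
    · simp only [map_real_cyl_zero, map_real_cyl_one]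
      refine Tendsto.log ?_ (hq r hr b).1.ne'
      rw [tendsto_iff_dist_tendsto_zero]
      refine squeeze_zero (fun _ => dist_nonneg) (fun n => ?_) hrate0
      rw [Real.dist_eq]
      exact (hq r hr b).2 n _
    · refine Tendsto.log ?_ (hc.trans_le (hQ b).1).ne'
      rw [← tendsto_add_atTop_iff_nat 1, Metric.tendsto_nhds]
      intro ε hε
      obtain ⟨n, hn⟩ := (hrate0.eventually (gt_mem_nhds (by positivity : 0 < ε / 3))).exists
      have hcyl : ∀ S k, Tendsto (fun r => (m (r + 1)).real (cylSet S k)) atTop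
          (𝓝 (μ.real (cylSet S k))) := fun S k =>
        tendsto_real_cylSet hT ht0 H hμ (fun r => hTχ (hχ (r + 1) (by omega)))
          (tendsto_approximant hψ fun r => hχ (r + 1) (by omega))
          (fun r => H' (r + 1) (by omega)) (fun r => hm' (r + 1) (by omega)) S k
      have hratio := (hcyl (fibers π b) (n + 1)).div (hcyl (fibers π (shift b)) n)
        ((hQ (shift b)).2 n).1.ne'
      filter_upwards [(Metric.tendsto_nhds.1 hratio) (ε / 3) (by positivity)] with r hr
      have h1 := abs_le.1 ((hq (r + 1) (by omega) b).2 n (Nat.sqrt n))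
      have h2 := abs_le.1 (((hQ b).2 n).2.2 (Nat.sqrt n))
      rw [Real.dist_eq, abs_lt] at hr ⊢
      simp only [Pi.div_apply] at hr
      constructor <;> linarith [h1.1, h1.2, h2.1, h2.2, hr.1, hr.2]
  · intro C c' γ hC hc' hγ _ h1
    exact exists_var_le_exp (by positivity) hvar hC hc' hγ h1
  · intro C q hC _ h1 ε hε hεq
    exact exists_var_le_rpow (by positivity) hvar hC hε hεq h1
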